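/- A pure $d$-dimensional simplicial complex $\Delta$ with $N$ facets is *constructible* if $d(N-1)=0$, or if $\Delta=\Delta_1\cup\Delta_2$ with $\Delta_1,\Delta_2$ constructible of dimension $d$ and $\Delta_1\cap\Delta_2$ constructible of dimension $d-1$. A *ridge* of $\Delta$ is a $(d-1)$-dimensional face; it is *free* if it is strictly contained in exactly one facet. A *clique* of $\Delta$ is a set of vertices all of whose $(d+1)$-element subsets are facets of $\Delta$; the *clique complex* $\operatorname{Cl}(\Delta)$ is the simplicial complex of all cliques. $\Delta$ is *ridge-chordal* if its set of facets can be reduced to the empty set by repeatedly deleting a ridge $r$ (that is, removing all facets that contain $r$) such that the vertices of the star of $r$ form a clique of the current complex. **Proposition.** For every integer $d\ge 2$ there is a shellable contractible $d$-dimensional simplicial complex $C_d$ on $2^d+d+1$ vertices that has exactly one free ridge $r$, such that for every integer $k\ge 2$ the complex $\Delta^d_k$ obtained by gluing $k$ copies of $C_d$ along $r$ (the $k$ copies of each vertex of $r$ are identified, and all other vertices are kept distinct) has the following properties: $\Delta^d_k$ is constructible, contractible and $d$-dimensional, has exactly $k2^d+k+d$ vertices, is not ridge-chordal, has no free ridge,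 and satisfies $\dim\operatorname{Cl}(\Delta^d_k)=d=\dim\Delta^d_k$. In particular, for all integers $d,k\ge 2$ there is a constructible, contractible $d$-dimensional simplicial complex on $k2^d+k+d$ vertices that is not ridge-chordal. -/

import Mathlib

namespace PreAbstractSimplicialComplex

/-- The vertex set of a simplicial complex: the points that form a face. -/
def vertexSet {V : Type*} (K : PreAbstractSimplicialComplex V) : Set V :=
  {v | {v} ∈ K.faces}

/-- The facets: the faces that are maximal under inclusion. -/
def facets {V : Type*} (K : PreAbstractSimplicialComplex V) : Set (Finset V) :=
  {s | s ∈ K.faces ∧ ∀ t ∈ K.faces, s ⊆ t → s = t}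

/-- `K` has dimension (exactly) `d`. A face with `m` vertices has dimension `m - 1`. -/
def HasDim {V : Type*} (d : ℕ) (K : PreAbstractSimplicialComplex V) : Prop :=
  (∃ s ∈ K.faces, s.card = d + 1) ∧ ∀ s ∈ K.faces, s.card ≤ d + 1

/-- `K` is pure of dimension `d`: it is `d`-dimensional and all its facets have dimension `d`. -/
def IsPure {V : Type*} (d : ℕ) (K : PreAbstractSimplicialComplex V) : Prop :=
  K.HasDim d ∧ ∀ s ∈ K.facets, s.card = d + 1

/-- `K` is a shellable (pure) `d`-dimensional complex: its facets can be listed as `F₀, F₁, …` so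
that for each `i ≥ 1` the intersection of `Fᵢ` with the subcomplex generated by the earlier facets
is pure of dimension `d - 1`, i.e. nonempty and generated by faces of `Fᵢ` with `d` vertices. -/
def IsShellable {V : Type*} [DecidableEq V] (d : ℕ) (K : PreAbstractSimplicialComplex V) : Prop :=
  K.IsPure d ∧ ∃ (N : ℕ) (F : Fin N → Finset V), Function.Injective F ∧ Set.range F = K.facets ∧
    ∀ i j : Fin N, j < i → ∃ m < i, F j ∩ F i ⊆ F m ∩ F i ∧ (F m ∩ F i).card = d

/-- Constructible pure complexes: a pure `d`-dimensional complex with `N` facets is constructible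
if `d = 0`, or if `N = 1`, or if it is the union of two constructible `d`-dimensional complexes
whose intersection is a constructible `(d - 1)`-dimensional complex. -/
inductive IsConstructible {V : Type*} : ℕ → PreAbstractSimplicialComplex V → Prop
  | dim_zero (K : PreAbstractSimplicialComplex V) (hK : K.IsPure 0) : IsConstructible 0 K
  | single_facet (d : ℕ) (K : PreAbstractSimplicialComplex V) (hK : K.IsPure d)
      (hN : ∃! s, s ∈ K.facets) : IsConstructible d K
  | union (d : ℕ) (K₁ K₂ : PreAbstractSimplicialComplex V) (h₁ : IsConstructible (d + 1) K₁)
      (h₂ : IsConstructible (d + 1) K₂) (h : IsConstructible d (K₁ ⊓ K₂)) :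
      IsConstructible (d + 1) (K₁ ⊔ K₂)

/-- The geometric realization of a simplicial complex on a finite vertex type: the union, over the
faces `s`, of the faces of the standard simplex spanned by `s`. -/
def realization {V : Type*} [Fintype V] (K : PreAbstractSimplicialComplex V) : Set (V → ℝ) :=
  {x | x ∈ stdSimplex ℝ V ∧ ∃ s ∈ K.faces, Function.support x ⊆ (s : Set V)}

/-- A complex is contractible if its geometric realization is a contractible space. -/
def IsContractible {V : Type*} [Fintype V] (K : PreAbstractSimplicialComplex V) : Prop :=
  ContractibleSpace K.realization

/-- A free ridge of a `d`-dimensional complex: a `(d - 1)`-dimensional face that is strictly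
contained in exactly one facet. -/
def IsFreeRidge {V : Type*} (d : ℕ) (K : PreAbstractSimplicialComplex V) (r : Finset V) : Prop :=
  r ∈ K.faces ∧ r.card = d ∧ ∃! F, F ∈ K.facets ∧ r ⊂ F

/-- `S` is a clique of a family `F` of `d`-dimensional simplices if every subset of `S` with `d + 1`
elements belongs to `F`. -/
def IsClique {V : Type*} (d : ℕ) (F : Set (Finset V)) (S : Set V) : Prop :=
  ∀ t : Finset V, (t : Set V) ⊆ S → t.card = d + 1 → t ∈ F

/-- The clique complex of a pure `d`-dimensional complex `K`: its faces are the (nonempty) sets of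
vertices of `K` all of whose subsets with `d + 1` elements are facets of `K`. -/
def cliqueComplex {V : Type*} (d : ℕ) (K : PreAbstractSimplicialComplex V) :
    PreAbstractSimplicialComplex V where
  faces := {s | s.Nonempty ∧ (s : Set V) ⊆ K.vertexSet ∧ IsClique d K.facets (s : Set V)}
  isRelLowerSet_faces := by
    rintro s ⟨hs, hv, hc⟩
    refine ⟨hs, fun t hts ht => ⟨ht, ?_, ?_⟩⟩
    · exact (Finset.coe_subset.mpr hts).trans hv
    · exact fun u hu hcard => hc u (hu.trans (Finset.coe_subset.mpr hts)) hcard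

/-- The vertices of the star of `r` in the pure complex with set of facets `F`. -/
def starVertices {V : Type*} (F : Set (Finset V)) (r : Finset V) : Set V :=
  {v | ∃ f ∈ F, r ⊆ f ∧ v ∈ f}

/-- A pure `d`-dimensional complex, given by its set `F` of facets, can be reduced to the empty set
by repeatedly deleting a ridge `r` (and with it all the facets containing `r`) such that the
vertices of the star of `r` form a clique of the current complex. -/
inductive RidgeReducible {V : Type*} (d : ℕ) : Set (Finset V) → Prop
  | empty : RidgeReducible d ∅
  | delete (F : Set (Finset V)) (r : Finset V) (hcard : r.card = d) (hr : ∃ f ∈ F, r ⊆ f)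
      (hclique : IsClique d F (starVertices F r))
      (hdel : RidgeReducible d {f | f ∈ F ∧ ¬ r ⊆ f}) : RidgeReducible d F

/-- Ridge-chordality of a pure `d`-dimensional complex. -/
def IsRidgeChordal {V : Type*} (d : ℕ) (K : PreAbstractSimplicialComplex V) : Prop :=
  RidgeReducible d K.facets

/-- The vertices of `k` copies of `V` glued along `r`: the points of `r` are shared, all the other
points of `V` occur `k` times. -/
abbrev GlueVertex {V : Type*} (r : Finset V) (k : ℕ) : Type _ :=
  {v // v ∈ r} ⊕ ({v // v ∉ r} × Fin k)

/-- The embedding of `V` as the `i`-th copy in `k` copies of `V` glued along `r`. -/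
def copyVertex {V : Type*} [DecidableEq V] (r : Finset V) {k : ℕ} (i : Fin k) (v : V) :
    GlueVertex r k :=
  if h : v ∈ r then Sum.inl ⟨v, h⟩ else Sum.inr (⟨v, h⟩, i)

/-- The complex obtained by gluing `k` copies of `K` along the face `r`: the union of the `k`
copies of `K`, any two of which share exactly the simplex `r` (and its subfaces). -/
def glueCopies {V : Type*} [DecidableEq V] (K : PreAbstractSimplicialComplex V) (r : Finset V)
    (k : ℕ) : PreAbstractSimplicialComplex (GlueVertex r k) :=
  ⨆ i : Fin k, K.map (copyVertex r i)

end PreAbstractSimplicialComplex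

/-!
# Constructible contractible complexes that are not ridge-chordal

The complex `C` comes with a *strict* shelling (`StrictShelling`): no facet is attached along its
whole boundary. Hence `C` is shellable. It is contractible, because each facet can be pushed back
into the earlier ones (`StrictShelling.isContractible`). It contains no boundary of a
`(d + 1)`-simplex, because the last facet of such a boundary would be attached along all its ridges
(`StrictShelling.card_ne_of_erase_mem`).

To find `C`, start in dimension 2 with an explicit dunce-hat-like complex on 7 vertices with a
single free edge (`sevenVertexTriangles`). The simplicial wedge at a vertex `a` replaces `a` by an
edge `ab` in all minimal non-faces. It raises the dimension and the number of vertices by one, keeps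
strict shellings, and turns a free ridge through `a` into a single free ridge. So if `a` is a vertex
of the only free ridge, there is again only one (`HasUniqueFreeRidge.wedge`). This gives a complex
with `d + 5` vertices in dimension `d`. As `d + 5 ≤ 2 ^ d + d + 1`, stellar subdivisions of facets
supply the missing vertices.

Now glue `k ≥ 2` copies of `C` along the free ridge `r`. Two copies meet in the simplex `r`, so the
result is constructible. It has no free ridge, as `r` now lies in `k` facets. A clique on `d + 2`
vertices would have to lie in a single copy, so there is none. But the star of a ridge that is not
free has at least `d + 2` vertices, so no ridge can be deleted and the complex is not ridge-chordal.

The glued complex does not collapse, so its contractibility needs another argument: a contraction of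
`C` can be modified so that `r` stays in `r` at all times (`IsContractible.exists_homotopicWith`).
The contractions of the copies then agree on their intersection and fit together
(`IsContractible.glueCopies`).
-/

open PreAbstractSimplicialComplex
open scoped unitInterval

/-! ### Strict shellings -/

/-- A strict shelling of a family of `n`-element sets (the facets of a pure complex): every new
facet `F` has a proper subset `S` such that the faces of `F` that are new are exactly those that
contain `S`. In a general shelling `S = F` is allowed too. Requiring `S ≠ F` says that no new facet
is attached along its whole boundary, so that the complex collapses to a point.
The first facet is the step with `S = ∅`. -/
inductive StrictShelling {V : Type*} (n : ℕ) : Set (Finset V) → Prop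
  | empty : StrictShelling n ∅
  | add (𝓕 : Set (Finset V)) (F S : Finset V) (h : StrictShelling n 𝓕) (hF : F.card = n)
      (hS : S ⊂ F) (hnew : ∀ τ ⊆ F, (∃ G ∈ 𝓕, τ ⊆ G) ↔ ¬ S ⊆ τ) : StrictShelling n (insert F 𝓕)

/-- `r` is the only free ridge of the pure `d`-dimensional complex with set of facets `𝓕`. -/
structure HasUniqueFreeRidge {V : Type*} (d : ℕ) (𝓕 : Set (Finset V)) (r : Finset V) : Prop where
  card_eq : r.card = d
  existsUnique : ∃! F, F ∈ 𝓕 ∧ r ⊆ F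
  exists_ne : ∀ ρ : Finset V, ρ.card = d → ρ ≠ r → ∀ F ∈ 𝓕, ρ ⊆ F → ∃ G ∈ 𝓕, G ≠ F ∧ ρ ⊆ G

namespace StrictShelling

variable {V W : Type*} {n : ℕ} {𝓕 : Set (Finset V)}

theorem card_eq (h : StrictShelling n 𝓕) : ∀ F ∈ 𝓕, F.card = n := by
  induction h with
  | empty => simp
  | add 𝓕 F S h hF hS hnew ih =>
    rintro G (rfl | hG)
    exacts [hF, ih G hG]

/-- A new facet is not contained in an earlier one, since it contains the restriction `S`. -/
theorem not_subset_of_new {F S : Finset V} (hS : S ⊂ F)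
    (hnew : ∀ τ ⊆ F, (∃ G ∈ 𝓕, τ ⊆ G) ↔ ¬ S ⊆ τ) : ∀ G ∈ 𝓕, ¬ F ⊆ G := fun G hG hFG =>
  (hnew F subset_rfl).1 ⟨G, hG, hFG⟩ hS.1

theorem image [DecidableEq W] (h : StrictShelling n 𝓕) {f : V → W} (hf : Function.Injective f) :
    StrictShelling n ((fun F => F.image f) '' 𝓕) := by
  induction h with
  | empty => simpa using StrictShelling.empty
  | add 𝓕 F S h hF hS hnew ih =>
    rw [Set.image_insert_eq]
    refine .add _ _ (S.image f) ih (by rwa [Finset.card_image_of_injective _ hf])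
      ((Finset.image_ssubset_image hf).2 hS) fun τ hτ => ?_
    obtain ⟨τ, hτF, rfl⟩ := Finset.subset_image_iff.1 hτ
    simp only [Set.exists_mem_image, Finset.image_subset_image_iff hf]
    exact hnew τ (by simpa using hτF)

/-- The ridges of a simplex that are opposite to the vertices of a proper subset admit a strict
shelling, in any order. -/
theorem erase_image [DecidableEq V] {G : Finset V} (hG : G.card = n + 1) (E : Finset V) (hE : E ⊂ G) :
    StrictShelling n ((fun v => G.erase v) '' (E : Set V)) := by
  induction E using Finset.induction_on with
  | empty => simpa using StrictShelling.empty
  | insert v E hv ih =>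
    have hvG : v ∈ G := hE.1 (Finset.mem_insert_self v E)
    rw [Finset.coe_insert, Set.image_insert_eq]
    refine .add _ _ E (ih ((Finset.ssubset_insert hv).trans hE))
      (by rw [Finset.card_erase_of_mem hvG, hG]; rfl) ?_ fun τ hτ => ?_
    · obtain ⟨x, hx, hxE⟩ := Finset.exists_of_ssubset hE
      rw [Finset.ssubset_iff_of_subset (by have := hE.1; grind)]
      exact ⟨x, by grind, by grind⟩
    · simp only [Set.exists_mem_image, Finset.mem_coe]
      constructor
      · grind
      · intro h
        obtain ⟨x, hx, hxτ⟩ := Finset.not_subset.1 h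
        exact ⟨x, hx, by grind⟩

end StrictShelling

section Operations

variable {V : Type*} [DecidableEq V] {n d : ℕ} {𝓕 : Set (Finset V)}

/-! ### Stellar subdivision of a facet -/

/-- The facets after the stellar subdivision of the facet `F` at a new vertex `z`. -/
def stack (𝓕 : Set (Finset V)) (F : Finset V) (z : V) : Set (Finset V) :=
  (𝓕 \ {F}) ∪ (fun v => (insert z F).erase v) '' (F : Set V)

theorem stack_covers_iff {F τ : Finset V} {z : V} (hF : F ∈ 𝓕) (hτ : ¬ F ⊆ τ) (hz : z ∉ τ) :
    (∃ G ∈ stack 𝓕 F z, τ ⊆ G) ↔ ∃ G ∈ 𝓕, τ ⊆ G := by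
  constructor
  · rintro ⟨G, ⟨hG, -⟩ | ⟨v, hv, rfl⟩, hτG⟩
    · exact ⟨G, hG, hτG⟩
    · exact ⟨F, hF, by grind⟩
  · rintro ⟨G, hG, hτG⟩
    by_cases hGF : G = F
    · subst hGF
      obtain ⟨v, hv, hvτ⟩ := Finset.not_subset.1 hτ
      exact ⟨_, .inr ⟨v, hv, rfl⟩, by grind⟩
    · exact ⟨G, .inl ⟨hG, hGF⟩, hτG⟩

/-- The facet that is subdivided is the first one of the shelling. -/
theorem StrictShelling.exists_stack (h : StrictShelling n 𝓕) (hne : 𝓕.Nonempty) :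
    ∃ F ∈ 𝓕, ∀ z, (∀ G ∈ 𝓕, z ∉ G) → StrictShelling n (stack 𝓕 F z) := by
  induction h with
  | empty => simp at hne
  | add 𝓕 F S h hF hS hnew ih =>
    rcases 𝓕.eq_empty_or_nonempty with rfl | hne'
    · refine ⟨F, by simp, fun z hz => ?_⟩
      have hzF : z ∉ F := hz F (by simp)
      have := erase_image (n := n) (G := insert z F) (by rw [Finset.card_insert_of_notMem hzF, hF]) F
        (Finset.ssubset_insert hzF)
      simpa [stack] using this
    · obtain ⟨F₀, hF₀, hst⟩ := ih hne'
      refine ⟨F₀, .inr hF₀, fun z hz => ?_⟩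
      have hFF₀ : F ≠ F₀ := fun e => not_subset_of_new hS hnew F₀ hF₀ e.subset
      have heq : stack (insert F 𝓕) F₀ z = insert F (stack 𝓕 F₀ z) := by
        ext G; simp only [stack, Set.mem_union, Set.mem_sdiff, Set.mem_insert_iff,
          Set.mem_singleton_iff]; grind
      rw [heq]
      refine .add _ _ S (hst z fun G hG => hz G (.inr hG)) hF hS fun τ hτ => ?_
      rw [stack_covers_iff hF₀ ?_ fun hzτ => hz F (.inl rfl) (hτ hzτ), hnew τ hτ]
      intro hF₀τ
      exact hFF₀ (Finset.eq_of_subset_of_card_le (hF₀τ.trans hτ)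
        (by rw [hF, h.card_eq F₀ hF₀])).symm

theorem HasUniqueFreeRidge.stack {r F : Finset V} {z : V} (h : HasUniqueFreeRidge d 𝓕 r)
    (hcard : ∀ G ∈ 𝓕, G.card = d + 1) (hF : F ∈ 𝓕) (hz : ∀ G ∈ 𝓕, z ∉ G) :
    HasUniqueFreeRidge d (stack 𝓕 F z) r := by
  have hzF := hz F hF
  -- a ridge of the old complex lies in one new facet if it lies in `F`
  have key : ∀ ρ : Finset V, ρ.card = d → ρ ⊆ F → ∃ v ∈ F, ρ = F.erase v := fun ρ hρ hρF => by
    obtain ⟨v, hv, hvρ⟩ := Finset.exists_of_ssubset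
      ((Finset.ssubset_iff_of_subset hρF).2 (by
        by_contra! hc
        have := Finset.card_le_card (show F ⊆ ρ from hc)
        have := hcard F hF
        omega))
    refine ⟨v, hv, Finset.eq_of_subset_of_card_le (by grind) ?_⟩
    rw [Finset.card_erase_of_mem hv, hcard F hF]; omega
  have hex : ∀ ρ : Finset V, ρ.card = d → ρ ⊆ F → ∃ G, (G ∈ (fun v => (insert z F).erase v) ''
      (F : Set V) ∧ ρ ⊆ G) ∧ ∀ G', G' ∈ (fun v => (insert z F).erase v) '' (F : Set V) →
      ρ ⊆ G' → G' = G := fun ρ hρ hρF => by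
    obtain ⟨v, hv, rfl⟩ := key ρ hρ hρF
    refine ⟨(insert z F).erase v, ⟨⟨v, hv, rfl⟩, by grind⟩, ?_⟩
    rintro _ ⟨u, hu, rfl⟩ hsub
    have : u = v := by
      by_contra hne
      have hu' : u ∈ F.erase v := Finset.mem_erase.2 ⟨hne, hu⟩
      simpa using hsub hu'
    rw [this]
  refine ⟨h.card_eq, ?_, fun ρ hρ hne G hG hρG => ?_⟩
  · obtain ⟨F₁, ⟨hF₁, hrF₁⟩, huniq⟩ := h.existsUnique
    by_cases hFF : F₁ = F
    · subst hFF
      obtain ⟨G, ⟨hG, hrG⟩, hGu⟩ := hex r h.card_eq hrF₁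
      refine ⟨G, ⟨.inr hG, hrG⟩, ?_⟩
      rintro G' ⟨⟨hG', hne⟩ | hG', hrG'⟩
      · exact absurd (huniq G' ⟨hG', hrG'⟩) hne
      · exact hGu G' hG' hrG'
    · refine ⟨F₁, ⟨.inl ⟨hF₁, hFF⟩, hrF₁⟩, ?_⟩
      rintro G' ⟨⟨hG', hne⟩ | ⟨v, hv, rfl⟩, hrG'⟩
      · exact huniq G' ⟨hG', hrG'⟩
      · have hzr : z ∉ r := fun hzr => hz F₁ hF₁ (hrF₁ hzr)
        exact absurd (huniq F ⟨hF, by grind⟩).symm hFF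
  · by_cases hzρ : z ∈ ρ
    · -- a ridge through `z` misses two vertices of `F`
      rcases hG with ⟨hG, -⟩ | ⟨v, hv, rfl⟩
      · exact absurd (hρG hzρ) (hz G hG)
      · have hlt : ((ρ.erase z)).card < (F.erase v).card := by
          have hpos : 0 < ρ.card := Finset.card_pos.2 ⟨z, hzρ⟩
          rw [Finset.card_erase_of_mem hzρ, Finset.card_erase_of_mem hv, hcard F hF]; omega
        obtain ⟨u, hu, huρ⟩ := Finset.exists_mem_notMem_of_card_lt_card hlt
        have huF : u ∈ F := Finset.mem_of_mem_erase hu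
        have huv : u ≠ v := Finset.ne_of_mem_erase hu
        have huz : u ≠ z := fun e => hzF (e ▸ huF)
        refine ⟨(insert z F).erase u, .inr ⟨u, huF, rfl⟩, fun e => ?_, ?_⟩
        · have : v ∈ (insert z F).erase u := by
            simp [huv.symm, show v ∈ F from hv]
          rw [e] at this; simp at this
        · intro x hx
          have := hρG hx
          grind
    · by_cases hρF : ρ ⊆ F
      · obtain ⟨G₁, hG₁, hG₁F, hρG₁⟩ := h.exists_ne ρ hρ hne F hF hρF
        obtain ⟨G₂, ⟨hG₂, hρG₂⟩, -⟩ := hex ρ hρ hρF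
        by_cases hGG : G = G₁
        · refine ⟨G₂, .inr hG₂, fun e => ?_, hρG₂⟩
          obtain ⟨v, hv, rfl⟩ := hG₂
          apply hz G₁ hG₁
          rw [← hGG, ← e]
          have : z ≠ v := fun e => hzF (e ▸ hv)
          simp [this]
        · exact ⟨G₁, .inl ⟨hG₁, hG₁F⟩, Ne.symm hGG, hρG₁⟩
      · rcases hG with ⟨hG, hGF⟩ | ⟨v, hv, rfl⟩
        · obtain ⟨G₁, hG₁, hG₁F, hρG₁⟩ := h.exists_ne ρ hρ hne G hG hρG
          exact ⟨G₁, .inl ⟨hG₁, fun e => hρF (e ▸ hρG₁)⟩, hG₁F, hρG₁⟩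
        · exact absurd (by grind) hρF

/-! ### The simplicial wedge -/

/-- The facets of the simplicial wedge at the vertex `a`, with the new vertex `b`: the minimal
non-faces that contain `a` now contain both `a` and `b`. It is the union of the suspension, with
apices `a` and `b`, of the deletion of `a`, and of the join of the edge `ab` with the link
of `a`. -/
def wedge (𝓕 : Set (Finset V)) (a b : V) : Set (Finset V) :=
  insert b '' 𝓕 ∪ insert a '' {F | F ∈ 𝓕 ∧ a ∉ F}

/-- A set `τ` is a face of the wedge exactly if its trace, in which `a` is kept only if both `a` and
`b` are in `τ`, is a face of the original complex. -/
theorem wedge_covers_iff {a b : V} (hab : a ≠ b) (hb : ∀ F ∈ 𝓕, b ∉ F) (τ : Finset V) :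
    (∃ G ∈ wedge 𝓕 a b, τ ⊆ G) ↔
      ∃ G ∈ 𝓕, (if a ∈ τ ∧ b ∈ τ then τ.erase b else (τ.erase a).erase b) ⊆ G := by
  constructor
  · rintro ⟨_, ⟨F, hF, rfl⟩ | ⟨F, ⟨hF, haF⟩, rfl⟩, hτ⟩
    · exact ⟨F, hF, by split_ifs <;> grind⟩
    · have := hb F hF
      exact ⟨F, hF, by split_ifs <;> grind⟩
  · rintro ⟨F, hF, hτ⟩
    by_cases h : b ∈ τ ∨ a ∈ F
    · exact ⟨_, .inl ⟨F, hF, rfl⟩, by split_ifs at hτ <;> grind⟩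
    · exact ⟨_, .inr ⟨F, ⟨hF, by tauto⟩, rfl⟩, by split_ifs at hτ <;> grind⟩

theorem StrictShelling.wedge {a b : V} (hab : a ≠ b) (h : StrictShelling n 𝓕)
    (hb : ∀ F ∈ 𝓕, b ∉ F) : StrictShelling (n + 1) (wedge 𝓕 a b) := by
  induction h with
  | empty => simpa [_root_.wedge] using StrictShelling.empty
  | add 𝓕 F S h hF hS hnew ih =>
    have hb' : ∀ G ∈ 𝓕, b ∉ G := fun G hG => hb G (.inr hG)
    specialize ih hb'
    have hbF : b ∉ F := hb F (.inl rfl)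
    have hSF := hS.1
    obtain ⟨x, hx, hxS⟩ := Finset.exists_of_ssubset hS
    by_cases haF : a ∈ F
    · have heq : _root_.wedge (insert F 𝓕) a b = insert (insert b F) (_root_.wedge 𝓕 a b) := by
        ext G; simp only [_root_.wedge, Set.mem_union, Set.mem_image, Set.mem_ofPred_eq,
          Set.mem_insert_iff]; grind
      rw [heq]
      refine .add _ _ (if a ∈ S then insert b S else S) ih (by simp [hbF, hF]) ?_ fun τ hτ => ?_
      · rw [Finset.ssubset_iff_of_subset (by grind)]
        exact ⟨x, by grind, by grind⟩
      · rw [wedge_covers_iff hab hb', hnew _ (by grind), not_iff_not]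
        grind
    · have heq : _root_.wedge (insert F 𝓕) a b =
          insert (insert b F) (insert (insert a F) (_root_.wedge 𝓕 a b)) := by
        ext G; simp only [_root_.wedge, Set.mem_union, Set.mem_image, Set.mem_ofPred_eq,
          Set.mem_insert_iff]; grind
      rw [heq]
      refine .add _ _ (insert b S) (.add _ _ S ih (by simp [haF, hF]) ?_ fun τ hτ => ?_)
        (by simp [hbF, hF]) ?_ fun τ hτ => ?_
      · rw [Finset.ssubset_iff_of_subset (by grind)]
        exact ⟨x, by grind, hxS⟩
      · rw [wedge_covers_iff hab hb', hnew _ (by grind), not_iff_not]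
        grind
      · rw [Finset.ssubset_iff_of_subset (by grind)]
        exact ⟨x, by grind, by grind⟩
      · rw [Set.exists_mem_insert, wedge_covers_iff hab hb', hnew _ (by grind)]
        grind

/-- If the free ridge contains the apex of the wedge, then its number does not grow. -/
theorem HasUniqueFreeRidge.wedge {a b : V} {r : Finset V} (hab : a ≠ b)
    (h : HasUniqueFreeRidge d 𝓕 r) (hcard : ∀ G ∈ 𝓕, G.card = d + 1) (har : a ∈ r)
    (hb : ∀ F ∈ 𝓕, b ∉ F) : HasUniqueFreeRidge (d + 1) (wedge 𝓕 a b) (insert b r) := by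
  obtain ⟨F₁, ⟨hF₁, hrF₁⟩, huniq⟩ := h.existsUnique
  have hbr : b ∉ r := fun hh => hb F₁ hF₁ (hrF₁ hh)
  refine ⟨by rw [Finset.card_insert_of_notMem hbr, h.card_eq],
    ⟨insert b F₁, ⟨.inl ⟨F₁, hF₁, rfl⟩, by grind⟩, ?_⟩, ?_⟩
  · rintro _ ⟨⟨G, hG, rfl⟩ | ⟨G, ⟨hG, haG⟩, rfl⟩, hsub⟩
    · rw [huniq G ⟨hG, (Finset.insert_subset_insert_iff hbr).1 hsub⟩]
    · have := hb G hG
      exact absurd (hsub (Finset.mem_insert_self b r)) (by grind)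
  -- Every other ridge is, up to the new vertex and the apex, a ridge of the old complex that is
  -- not free, or an old facet.
  rintro ρ hρ hne _ (⟨F, hF, rfl⟩ | ⟨F, ⟨hF, haF⟩, rfl⟩) hsub
  · have hbF := hb F hF
    by_cases hbρ : b ∈ ρ
    · obtain ⟨G, hG, hGF, hρG⟩ := h.exists_ne (ρ.erase b)
        (by rw [Finset.card_erase_of_mem hbρ, hρ]; rfl)
        (fun e => hne (by rw [← e, Finset.insert_erase hbρ])) F hF (by grind)
      have hbG := hb G hG
      exact ⟨_, .inl ⟨G, hG, rfl⟩, fun e => hGF (by grind), by grind⟩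
    · have hρF : ρ = F := Finset.eq_of_subset_of_card_le (by grind) (by rw [hρ, hcard F hF])
      subst hρF
      by_cases haρ : a ∈ ρ
      · obtain ⟨G, hG, hGF, hρG⟩ := h.exists_ne (ρ.erase a)
          (by rw [Finset.card_erase_of_mem haρ, hρ]; rfl) (by grind) ρ hF (by grind)
        have haG : a ∉ G := fun haG => hGF (Finset.eq_of_subset_of_card_le (by grind)
          (by rw [hρ, hcard G hG])).symm
        exact ⟨_, .inr ⟨G, ⟨hG, haG⟩, rfl⟩, fun e => by have := hb G hG; grind, by grind⟩
      · exact ⟨_, .inr ⟨ρ, ⟨hF, haρ⟩, rfl⟩, fun e => by grind, by grind⟩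
  · have hbF := hb F hF
    by_cases haρ : a ∈ ρ
    · obtain ⟨G, hG, hGF, hρG⟩ := h.exists_ne (ρ.erase a)
        (by rw [Finset.card_erase_of_mem haρ, hρ]; rfl) (by grind) F hF (by grind)
      by_cases haG : a ∈ G
      · exact ⟨_, .inl ⟨G, hG, rfl⟩, fun e => by grind, by grind⟩
      · exact ⟨_, .inr ⟨G, ⟨hG, haG⟩, rfl⟩, fun e => hGF (by grind), by grind⟩
    · have hρF : ρ = F := Finset.eq_of_subset_of_card_le (by grind) (by rw [hρ, hcard F hF])
      subst hρF
      exact ⟨_, .inl ⟨ρ, hF, rfl⟩, fun e => by grind, by grind⟩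

end Operations

/-! ### A complex with one free ridge, in every dimension -/

theorem StrictShelling.cons {V : Type*} [DecidableEq V] {n : ℕ} {L : List (Finset V)}
    (F S : Finset V) (hF : F.card = n) (hS : S ⊂ F)
    (hnew : ∀ τ ∈ F.powerset, (∃ G ∈ L, τ ⊆ G) ↔ ¬ S ⊆ τ) (h : StrictShelling n {G | G ∈ L}) :
    StrictShelling n {G | G ∈ F :: L} := by
  have : {G | G ∈ F :: L} = insert F {G | G ∈ L} := by ext; simp
  rw [this]
  exact .add _ F S h hF hS fun τ hτ => hnew τ (by simpa using hτ)

/-- The triangles of a 2-dimensional complex on 7 vertices whose only free edge is `{0, 3}`.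
The triangles `{0, 1, 2}` and `{1, 2, 3}` form a square, and the others form a heptagon with inner
vertices `4`, `5`, `6`. Six sides of the heptagon are glued along the path `0, 1, 3, 2, 0, 1, 3`,
which covers all sides of the square, and the seventh is the free edge. -/
def sevenVertexTriangles : List (Finset (Fin 7)) :=
  [{0, 3, 6}, {3, 5, 6}, {1, 3, 5}, {0, 1, 5}, {0, 2, 5}, {0, 1, 2}, {1, 2, 3}, {4, 5, 6},
    {0, 4, 6}, {2, 4, 5}, {2, 3, 4}, {1, 3, 4}, {0, 1, 4}]

theorem strictShelling_sevenVertexTriangles :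
    StrictShelling 3 {F | F ∈ sevenVertexTriangles} := by
  refine .cons _ {0, 3} (by decide) (by decide) (by decide +kernel) ?_
  refine .cons _ {3, 6} (by decide) (by decide) (by decide +kernel) ?_
  refine .cons _ {3, 5} (by decide) (by decide) (by decide +kernel) ?_
  refine .cons _ {1, 5} (by decide) (by decide) (by decide +kernel) ?_
  refine .cons _ {0, 5} (by decide) (by decide) (by decide +kernel) ?_
  refine .cons _ {0, 2} (by decide) (by decide) (by decide +kernel) ?_
  refine .cons _ {1, 2} (by decide) (by decide) (by decide +kernel) ?_
  refine .cons _ {5, 6} (by decide) (by decide) (by decide +kernel) ?_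
  refine .cons _ {6} (by decide) (by decide) (by decide +kernel) ?_
  refine .cons _ {5} (by decide) (by decide) (by decide +kernel) ?_
  refine .cons _ {2} (by decide) (by decide) (by decide +kernel) ?_
  refine .cons _ {3} (by decide) (by decide) (by decide +kernel) ?_
  refine .cons _ ∅ (by decide) (by decide) (by decide +kernel) ?_
  simpa using StrictShelling.empty

theorem hasUniqueFreeRidge_sevenVertexTriangles :
    HasUniqueFreeRidge 2 {F | F ∈ sevenVertexTriangles} {0, 3} := by
  refine ⟨by decide, ⟨{0, 3, 6}, ⟨by decide, by decide⟩, ?_⟩, ?_⟩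
  · rintro F ⟨hF, hr⟩
    exact (by decide +kernel : ∀ F ∈ sevenVertexTriangles, {0, 3} ⊆ F → F = {0, 3, 6}) F hF hr
  · intro ρ hρ hne F hF hρF
    exact (by decide +kernel : ∀ F ∈ sevenVertexTriangles, ∀ ρ ∈ F.powersetCard 2, ρ ≠ {0, 3} →
      ∃ G ∈ sevenVertexTriangles, G ≠ F ∧ ρ ⊆ G) F hF ρ
      (Finset.mem_powersetCard.2 ⟨hρF, hρ⟩) hne

theorem HasUniqueFreeRidge.image {V W : Type*} [DecidableEq W] {d : ℕ}
    {𝓕 : Set (Finset V)} {r : Finset V} (h : HasUniqueFreeRidge d 𝓕 r) {f : V → W}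
    (hf : Function.Injective f) :
    HasUniqueFreeRidge d ((fun F => F.image f) '' 𝓕) (r.image f) := by
  obtain ⟨F₁, ⟨hF₁, hrF₁⟩, huniq⟩ := h.existsUnique
  refine ⟨by rw [Finset.card_image_of_injective _ hf, h.card_eq],
    ⟨F₁.image f, ⟨⟨F₁, hF₁, rfl⟩, Finset.image_mono f hrF₁⟩, ?_⟩, ?_⟩
  · rintro _ ⟨⟨G, hG, rfl⟩, hsub⟩
    rw [huniq G ⟨hG, (Finset.image_subset_image_iff hf).1 hsub⟩]
  · rintro ρ hρ hne _ ⟨F, hF, rfl⟩ hsub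
    obtain ⟨ρ, hρF, rfl⟩ := Finset.subset_image_iff.1 hsub
    obtain ⟨G, hG, hGF, hρG⟩ := h.exists_ne ρ (by rwa [Finset.card_image_of_injective _ hf] at hρ)
      (fun e => hne (by rw [e])) F hF (by simpa using hρF)
    exact ⟨_, ⟨G, hG, rfl⟩, fun e => hGF (Finset.image_injective hf e), Finset.image_mono f hρG⟩

/-- Starting from the seven-vertex complex, each simplicial wedge at a vertex of the free ridge
raises the dimension and the number of vertices by one. The finset `U` is the set of vertices in
use. -/
theorem exists_strictShelling_card_add_five {N d : ℕ} (hd : 2 ≤ d) (hN : d + 5 ≤ N) :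
    ∃ (𝓕 : Set (Finset (Fin N))) (r U : Finset (Fin N)), StrictShelling (d + 1) 𝓕 ∧
      HasUniqueFreeRidge d 𝓕 r ∧ (∀ v, v ∈ U ↔ ∃ F ∈ 𝓕, v ∈ F) ∧ U.card = d + 5 := by
  induction d, hd using Nat.le_induction with
  | base =>
    have hf := Fin.castLE_injective hN
    refine ⟨_, _, Finset.univ.image (Fin.castLE hN),
      strictShelling_sevenVertexTriangles.image hf,
      hasUniqueFreeRidge_sevenVertexTriangles.image hf, fun v => ?_, ?_⟩
    · simp only [Set.exists_mem_image, Finset.mem_image, Finset.mem_univ, true_and]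
      constructor
      · rintro ⟨u, rfl⟩
        obtain ⟨F, hF, huF⟩ :=
          (by decide +kernel : ∀ u, ∃ F ∈ sevenVertexTriangles, u ∈ F) u
        exact ⟨F, hF, u, huF, rfl⟩
      · rintro ⟨F, -, u, -, rfl⟩
        exact ⟨u, rfl⟩
    · rw [Finset.card_image_of_injective _ hf]; rfl
  | succ d hd ih =>
    obtain ⟨𝓕, r, U, hsh, hr, hU, hUc⟩ := ih (by omega)
    obtain ⟨b, -, hb⟩ := Finset.exists_mem_notMem_of_card_lt_card
      (show U.card < (Finset.univ : Finset (Fin N)).card by rw [Finset.card_fin]; omega)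
    obtain ⟨a, ha⟩ : r.Nonempty := Finset.card_pos.1 (by rw [hr.card_eq]; omega)
    obtain ⟨F₁, ⟨hF₁, hrF₁⟩, -⟩ := hr.existsUnique
    have hb' : ∀ F ∈ 𝓕, b ∉ F := fun F hF hbF => hb ((hU b).2 ⟨F, hF, hbF⟩)
    have hab : a ≠ b := fun e => hb' F₁ hF₁ (hrF₁ (e ▸ ha))
    refine ⟨_, _, insert b U, hsh.wedge hab hb', hr.wedge hab hsh.card_eq ha hb', fun v => ?_, ?_⟩
    · rw [Finset.mem_insert, hU]
      constructor
      · rintro (rfl | ⟨F, hF, hv⟩)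
        · exact ⟨_, .inl ⟨F₁, hF₁, rfl⟩, by simp⟩
        · exact ⟨_, .inl ⟨F, hF, rfl⟩, by simp [hv]⟩
      · rintro ⟨_, ⟨F, hF, rfl⟩ | ⟨F, ⟨hF, -⟩, rfl⟩, hv⟩
        · grind
        · rcases Finset.mem_insert.1 hv with rfl | hv
          · exact .inr ⟨F₁, hF₁, hrF₁ ha⟩
          · exact .inr ⟨F, hF, hv⟩
    · rw [Finset.card_insert_of_notMem hb, hUc]

/-- Each stellar subdivision of a facet adds one vertex and keeps the dimension and the free
ridge. -/
theorem exists_strictShelling {N d m : ℕ} (hd : 2 ≤ d) (hm : d + 5 ≤ m) (hN : m ≤ N) :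
    ∃ (𝓕 : Set (Finset (Fin N))) (r U : Finset (Fin N)), StrictShelling (d + 1) 𝓕 ∧
      HasUniqueFreeRidge d 𝓕 r ∧ (∀ v, v ∈ U ↔ ∃ F ∈ 𝓕, v ∈ F) ∧ U.card = m := by
  induction m, hm using Nat.le_induction with
  | base => exact exists_strictShelling_card_add_five hd hN
  | succ m hm ih =>
    obtain ⟨𝓕, r, U, hsh, hr, hU, hUc⟩ := ih (by omega)
    obtain ⟨z, -, hz⟩ := Finset.exists_mem_notMem_of_card_lt_card
      (show U.card < (Finset.univ : Finset (Fin N)).card by rw [Finset.card_fin]; omega)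
    have hz' : ∀ F ∈ 𝓕, z ∉ F := fun F hF hzF => hz ((hU z).2 ⟨F, hF, hzF⟩)
    obtain ⟨F₁, ⟨hF₁, -⟩, -⟩ := hr.existsUnique
    obtain ⟨F, hF, hst⟩ := hsh.exists_stack ⟨F₁, hF₁⟩
    have hFc := hsh.card_eq F hF
    refine ⟨_, _, insert z U, hst z hz', hr.stack hsh.card_eq hF hz', fun v => ?_, ?_⟩
    · rw [Finset.mem_insert, hU]
      constructor
      · intro hv
        by_cases hvF : v ∈ F ∨ v = z
        · obtain ⟨u, hu, huv⟩ := Finset.exists_mem_ne (by omega : 1 < F.card) v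
          exact ⟨_, .inr ⟨u, hu, rfl⟩, by grind⟩
        · obtain rfl | ⟨G, hG, hv⟩ := hv
          · simp at hvF
          · exact ⟨G, .inl ⟨hG, fun e => hvF (.inl (e ▸ hv))⟩, hv⟩
      · rintro ⟨_, ⟨hG, -⟩ | ⟨u, hu, rfl⟩, hv⟩
        · exact .inr ⟨_, hG, hv⟩
        · by_cases hvz : v = z
          · exact .inl hvz
          · exact .inr ⟨F, hF, by grind⟩
    · rw [Finset.card_insert_of_notMem hz, hUc]

/-! ### Complexes given by their facets -/

namespace PreAbstractSimplicialComplex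

variable {V : Type*} {n d : ℕ} {𝓕 : Set (Finset V)}

/-- The simplicial complex generated by a family of sets. -/
def generatedBy (𝓕 : Set (Finset V)) : PreAbstractSimplicialComplex V where
  faces := {s | s.Nonempty ∧ ∃ F ∈ 𝓕, s ⊆ F}
  isRelLowerSet_faces := by
    rintro s ⟨hs, F, hF, hsF⟩
    exact ⟨hs, fun t hts ht => ⟨ht, F, hF, hts.trans hsF⟩⟩

theorem mem_faces_generatedBy {s : Finset V} :
    s ∈ (generatedBy 𝓕).faces ↔ s.Nonempty ∧ ∃ F ∈ 𝓕, s ⊆ F := Iff.rfl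

theorem facets_generatedBy (h : ∀ F ∈ 𝓕, F.card = d + 1) : (generatedBy 𝓕).facets = 𝓕 := by
  have hne : ∀ F ∈ 𝓕, F ∈ (generatedBy 𝓕).faces := fun F hF =>
    ⟨Finset.card_pos.1 (by rw [h F hF]; omega), F, hF, subset_rfl⟩
  ext s
  constructor
  · rintro ⟨⟨-, F, hF, hsF⟩, hmax⟩
    rwa [hmax F (hne F hF) hsF]
  · refine fun hs => ⟨hne s hs, ?_⟩
    rintro t ⟨-, F, hF, htF⟩ hst
    have : s = F := Finset.eq_of_subset_of_card_le (hst.trans htF) (by rw [h s hs, h F hF])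
    exact hst.antisymm (this ▸ htF)

theorem hasDim_generatedBy (h : ∀ F ∈ 𝓕, F.card = d + 1) (hne : 𝓕.Nonempty) :
    (generatedBy 𝓕).HasDim d := by
  obtain ⟨F, hF⟩ := hne
  refine ⟨⟨F, ⟨Finset.card_pos.1 (by rw [h F hF]; omega), F, hF, subset_rfl⟩, h F hF⟩, ?_⟩
  rintro s ⟨-, G, hG, hsG⟩
  exact h G hG ▸ Finset.card_le_card hsG

theorem isPure_generatedBy (h : ∀ F ∈ 𝓕, F.card = d + 1) (hne : 𝓕.Nonempty) :
    (generatedBy 𝓕).IsPure d :=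
  ⟨hasDim_generatedBy h hne, by rwa [facets_generatedBy h]⟩

theorem isConstructible_generatedBy_singleton {F : Finset V} (hF : F.card = d + 1) :
    (generatedBy {F}).IsConstructible d := by
  have h : ∀ G ∈ ({F} : Set (Finset V)), G.card = d + 1 := by simpa using hF
  refine .single_facet d _ (isPure_generatedBy h (Set.singleton_nonempty F)) ?_
  rw [facets_generatedBy h]
  exact ⟨F, rfl, fun _ h => h⟩

theorem generatedBy_union (𝓕 𝓖 : Set (Finset V)) :
    generatedBy (𝓕 ∪ 𝓖) = generatedBy 𝓕 ⊔ generatedBy 𝓖 := by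
  apply PreAbstractSimplicialComplex.ext
  change _ = (generatedBy 𝓕).faces ∪ (generatedBy 𝓖).faces
  ext s
  simp only [Set.mem_union, mem_faces_generatedBy]
  grind

theorem mem_faces_inf {K L : PreAbstractSimplicialComplex V} {s : Finset V} :
    s ∈ (K ⊓ L).faces ↔ s ∈ K.faces ∧ s ∈ L.faces := Iff.rfl

theorem isFreeRidge_generatedBy_iff (h : ∀ F ∈ 𝓕, F.card = d + 1) (hd : d ≠ 0) {r : Finset V} :
    (generatedBy 𝓕).IsFreeRidge d r ↔ r.card = d ∧ ∃! F, F ∈ 𝓕 ∧ r ⊆ F := by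
  have key : ∀ F, r.card = d → (F ∈ 𝓕 ∧ r ⊂ F ↔ F ∈ 𝓕 ∧ r ⊆ F) := fun F hr =>
    and_congr_right fun hF => ⟨fun hs => hs.1, fun hs => ⟨hs, fun hs' => by
      have := Finset.card_le_card hs'
      have := h F hF
      omega⟩⟩
  rw [IsFreeRidge, facets_generatedBy h]
  constructor
  · rintro ⟨-, hr, hu⟩
    simp only [key _ hr] at hu
    exact ⟨hr, hu⟩
  · rintro ⟨hr, hu⟩
    refine ⟨⟨Finset.card_pos.1 (by omega), hu.exists⟩, hr, ?_⟩
    simpa only [key _ hr] using hu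

end PreAbstractSimplicialComplex

namespace HasUniqueFreeRidge

variable {V : Type*} {d : ℕ} {𝓕 : Set (Finset V)} {r : Finset V}

theorem isFreeRidge (h : HasUniqueFreeRidge d 𝓕 r) (hcard : ∀ F ∈ 𝓕, F.card = d + 1)
    (hd : d ≠ 0) : (generatedBy 𝓕).IsFreeRidge d r :=
  (isFreeRidge_generatedBy_iff hcard hd).2 ⟨h.card_eq, h.existsUnique⟩

theorem eq_of_isFreeRidge (h : HasUniqueFreeRidge d 𝓕 r) (hcard : ∀ F ∈ 𝓕, F.card = d + 1)
    (hd : d ≠ 0) {ρ : Finset V} (hρ : (generatedBy 𝓕).IsFreeRidge d ρ) : ρ = r := by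
  obtain ⟨hρc, F, ⟨hF, hρF⟩, hu⟩ := (isFreeRidge_generatedBy_iff hcard hd).1 hρ
  by_contra hne
  obtain ⟨G, hG, hGF, hρG⟩ := h.exists_ne ρ hρc hne F hF hρF
  exact hGF (hu G ⟨hG, hρG⟩)

end HasUniqueFreeRidge

namespace StrictShelling

variable {V : Type*} {n d : ℕ} {𝓕 : Set (Finset V)}

/-! ### Consequences of strict shellings -/

/-- The last facet of a strict shelling is not attached along its whole boundary, so it cannot be
part of the boundary of a simplex. -/
theorem card_ne_of_erase_mem [DecidableEq V] (h : StrictShelling n 𝓕) {T : Finset V}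
    (hn : n ≠ 0) (hT : ∀ v ∈ T, T.erase v ∈ 𝓕) : T.card ≠ n + 1 := by
  intro hTc
  induction h with
  | empty =>
    obtain ⟨v, hv⟩ : T.Nonempty := Finset.card_pos.1 (by omega)
    exact hT v hv
  | add 𝓕 F S h hF hS hnew ih =>
    by_cases hlast : ∃ v ∈ T, F = T.erase v
    · obtain ⟨v, hv, rfl⟩ := hlast
      obtain ⟨u, hu, huS⟩ : ∃ u ∈ T.erase v, u ∈ S := by
        by_contra! hc
        obtain ⟨u, hu⟩ : (T.erase v).Nonempty := Finset.card_pos.1 (by omega)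
        have hSe : S = ∅ := by
          rw [Finset.eq_empty_iff_forall_notMem]
          exact fun x hx => hc x (hS.1 hx) hx
        subst hSe
        have huT := Finset.mem_of_mem_erase hu
        rcases hT u huT with he | hmem
        · exact Finset.ne_of_mem_erase hu (Finset.erase_injOn T huT hv he)
        · exact (hnew ∅ (by simp)).1 ⟨_, hmem, by simp⟩ subset_rfl
      obtain ⟨x, hx, hxS⟩ := Finset.exists_of_ssubset hS
      have hxT := Finset.mem_of_mem_erase hx
      rcases hT x hxT with he | hmem
      · exact Finset.ne_of_mem_erase hx (Finset.erase_injOn T hxT hv he)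
      · exact (hnew ((T.erase v).erase x) (Finset.erase_subset _ _)).1
          ⟨_, hmem, by grind⟩ (by have := hS.1; grind)
    · push Not at hlast
      exact ih fun v hv => (hT v hv).resolve_left (hlast v hv).symm

theorem isShellable [DecidableEq V] (h : StrictShelling (d + 1) 𝓕) (hne : 𝓕.Nonempty) :
    (generatedBy 𝓕).IsShellable d := by
  refine ⟨isPure_generatedBy h.card_eq hne, ?_⟩
  rw [facets_generatedBy h.card_eq]
  clear hne
  induction h with
  | empty => exact ⟨0, Fin.elim0, fun i => i.elim0, by simp, fun i => i.elim0⟩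
  | add 𝓕 F S h hF hS hnew ih =>
    obtain ⟨N, G, hinj, hrange, hG⟩ := ih
    have hmem : ∀ j, G j ∈ 𝓕 := fun j => hrange ▸ Set.mem_range_self j
    refine ⟨N + 1, Fin.snoc G F, ?_, ?_, ?_⟩
    · rw [Fin.snoc_injective_iff]
      exact ⟨hinj, fun hc => not_subset_of_new hS hnew F (hrange ▸ hc) subset_rfl⟩
    · rw [Fin.range_snoc, hrange]
    · intro i j hji
      induction i using Fin.lastCases with
      | last =>
        induction j using Fin.lastCases with
        | last => exact absurd hji (lt_irrefl _)
        | cast j =>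
          simp only [Fin.snoc_last, Fin.snoc_castSucc]
          -- the new facet meets the facet `G j` in a face that avoids some vertex `s` of `S`
          obtain ⟨s, hs, hsj⟩ := Finset.not_subset.1
            ((hnew (G j ∩ F) Finset.inter_subset_right).1
              ⟨G j, hmem j, Finset.inter_subset_left⟩)
          have hsF := hS.1 hs
          obtain ⟨G', hG', hsub⟩ := (hnew (F.erase s) (Finset.erase_subset _ _)).2
            fun hc => Finset.notMem_erase s F (hc hs)
          rw [← hrange] at hG'
          obtain ⟨m, rfl⟩ := hG'
          refine ⟨m.castSucc, Fin.castSucc_lt_last m, ?_⟩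
          rw [Fin.snoc_castSucc]
          have hsm : s ∉ G m := fun hsm => not_subset_of_new hS hnew _ (hmem m) (by grind)
          have heq : G m ∩ F = F.erase s := by grind
          rw [heq, Finset.card_erase_of_mem hsF, hF]
          exact ⟨by grind, rfl⟩
      | cast i =>
        induction j using Fin.lastCases with
        | last => exact absurd hji (Fin.castSucc_lt_last i).not_gt
        | cast j =>
          obtain ⟨m, hm, hsub, hc⟩ := hG i j (by simpa using hji)
          exact ⟨m.castSucc, by simpa using hm, by simpa using hsub, by simpa using hc⟩

/-- The intersection of a new facet with the union of the earlier ones is generated by the ridges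
opposite to the vertices of `S`, which form a strictly shellable complex themselves. -/
theorem isConstructible [DecidableEq V] (h : StrictShelling (d + 1) 𝓕) (hne : 𝓕.Nonempty) :
    (generatedBy 𝓕).IsConstructible d := by
  induction d generalizing 𝓕 with
  | zero => exact .dim_zero _ (isPure_generatedBy h.card_eq hne)
  | succ d ihd =>
    induction h with
    | empty => simp at hne
    | add 𝓕 F S h hF hS hnew ih =>
      rcases 𝓕.eq_empty_or_nonempty with rfl | hne'
      · simpa using isConstructible_generatedBy_singleton hF
      · rw [← Set.union_singleton, generatedBy_union]
        refine .union d _ _ (ih hne') (isConstructible_generatedBy_singleton hF) ?_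
        have hSne : S.Nonempty := by
          by_contra hc
          rw [Finset.not_nonempty_iff_eq_empty] at hc
          obtain ⟨G, hG⟩ := hne'
          exact (hnew ∅ (by simp)).1 ⟨G, hG, by simp⟩ (by simp [hc])
        have := ihd (erase_image hF S hS) (hSne.to_set.image _)
        convert! this using 1
        apply PreAbstractSimplicialComplex.ext
        ext s
        simp only [mem_faces_inf, mem_faces_generatedBy, Set.mem_singleton_iff, exists_eq_left,
          Set.exists_mem_image, Finset.mem_coe]
        constructor
        · rintro ⟨⟨hs, hcov⟩, -, hsF⟩
          obtain ⟨v, hv, hvs⟩ := Finset.not_subset.1 ((hnew s hsF).1 hcov)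
          exact ⟨hs, v, hv, by grind⟩
        · rintro ⟨hs, v, hv, hsv⟩
          have hsF : s ⊆ F := hsv.trans (Finset.erase_subset _ _)
          exact ⟨⟨hs, (hnew s hsF).2 fun hc => Finset.notMem_erase v F (hsv (hc hv))⟩, hs, hsF⟩

end StrictShelling

/-! ### Homotopies in the geometric realization -/

theorem support_lineMap_subset {V : Type*} {x y : V → ℝ} {s : Set V}
    (hx : Function.support x ⊆ s) (hy : Function.support y ⊆ s) (t : ℝ) :
    Function.support (AffineMap.lineMap x y t) ⊆ s := fun v hv => by
  by_contra hvs
  have h1 : x v = 0 := by_contra fun h => hvs (hx h)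
  have h2 : y v = 0 := by_contra fun h => hvs (hy h)
  exact hv (by simp [AffineMap.lineMap_apply, h1, h2])

namespace PreAbstractSimplicialComplex

variable {V : Type*} [Fintype V] {𝓕 : Set (Finset V)}

theorem mem_realization_generatedBy {x : V → ℝ} : x ∈ (generatedBy 𝓕).realization ↔
    x ∈ stdSimplex ℝ V ∧ ∃ F ∈ 𝓕, Function.support x ⊆ (F : Set V) := by
  classical
  refine and_congr_right fun hx => ⟨?_, ?_⟩
  · rintro ⟨s, ⟨-, F, hF, hsF⟩, hxs⟩
    exact ⟨F, hF, hxs.trans (Finset.coe_subset.2 hsF)⟩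
  · rintro ⟨F, hF, hxF⟩
    refine ⟨Finset.univ.filter fun v => x v ≠ 0, ⟨?_, F, hF, ?_⟩, ?_⟩
    · by_contra hc
      rw [Finset.not_nonempty_iff_eq_empty, Finset.filter_eq_empty_iff] at hc
      have := hx.2
      rw [Finset.sum_eq_zero fun v hv => by simpa using hc hv] at this
      exact zero_ne_one this
    · exact fun v hv => hxF (by simpa using hv)
    · exact fun v hv => by simpa using hv

theorem single_mem_realization [DecidableEq V] {F : Finset V} (hF : F ∈ 𝓕) {v : V} (hv : v ∈ F) :
    (Pi.single v 1 : V → ℝ) ∈ (generatedBy 𝓕).realization :=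
  mem_realization_generatedBy.2 ⟨single_mem_stdSimplex ℝ v, F, hF,
    (Pi.support_single_subset).trans (by simpa using hv)⟩

theorem lineMap_mem_realization {x y : V → ℝ} (hx : x ∈ stdSimplex ℝ V) (hy : y ∈ stdSimplex ℝ V)
    (h : ∃ F ∈ 𝓕, Function.support x ⊆ (F : Set V) ∧ Function.support y ⊆ (F : Set V)) {t : ℝ}
    (ht : t ∈ Set.Icc (0 : ℝ) 1) :
    AffineMap.lineMap x y t ∈ (generatedBy 𝓕).realization := by
  obtain ⟨F, hF, hxF, hyF⟩ := h
  refine mem_realization_generatedBy.2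
    ⟨(convex_stdSimplex ℝ V).lineMap_mem hx hy ht, F, hF,
      support_lineMap_subset hxF hyF t⟩

/-- Two maps into the realization are homotopic along segments if their values at each point lie
in a common facet. -/
theorem homotopicWith_of_common_facet {X : Type*} [TopologicalSpace X]
    (f g : C(X, (generatedBy 𝓕).realization)) (P : C(X, (generatedBy 𝓕).realization) → Prop)
    (h : ∀ x, ∃ F ∈ 𝓕, Function.support (f x).1 ⊆ (F : Set V) ∧
      Function.support (g x).1 ⊆ (F : Set V))
    (hP : ∀ (t : I) (e : C(X, (generatedBy 𝓕).realization)),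
      (∀ x, (e x).1 = AffineMap.lineMap (f x).1 (g x).1 (t : ℝ)) → P e) :
    f.HomotopicWith g P := by
  refine ⟨⟨⟨⟨fun p => ⟨AffineMap.lineMap (f p.2).1 (g p.2).1 (p.1 : ℝ),
    lineMap_mem_realization (f p.2).2.1 (g p.2).2.1 (h p.2) p.1.2⟩, ?_⟩, ?_, ?_⟩, ?_⟩⟩
  · simp only [AffineMap.lineMap_apply_module]
    fun_prop
  · intro x; ext; simp
  · intro x; ext; simp
  · intro t; exact hP t _ fun x => rfl

theorem homotopic_of_common_facet {X : Type*} [TopologicalSpace X]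
    (f g : C(X, (generatedBy 𝓕).realization))
    (h : ∀ x, ∃ F ∈ 𝓕, Function.support (f x).1 ⊆ (F : Set V) ∧
      Function.support (g x).1 ⊆ (F : Set V)) : f.Homotopic g :=
  (homotopicWith_of_common_facet f g (fun _ => True) h fun _ _ _ => trivial).elim
    fun H => ⟨H.toHomotopy⟩

end PreAbstractSimplicialComplex

/-! ### Strictly shellable complexes are contractible -/

section Push

variable {V : Type*} (S : Finset V) (hS : S.Nonempty) (a : V)

/-- The map that lowers all coordinates in `S` at the same rate until one of them vanishes, and
gives the mass to the vertex `a`. -/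
def pushMap [DecidableEq V] (x : V → ℝ) : V → ℝ := fun v =>
  x v - (if v ∈ S then S.inf' hS x else 0) + (if v = a then S.card * S.inf' hS x else 0)

theorem continuous_pushMap [DecidableEq V] : Continuous (pushMap S hS a) := by
  have h : Continuous fun x : V → ℝ => S.inf' hS x :=
    Continuous.finset_inf'_apply hS fun i _ => continuous_apply i
  refine continuous_pi fun v => ?_
  unfold pushMap
  split_ifs <;> fun_prop

variable {S a}

theorem inf'_nonneg_of_mem_stdSimplex [Fintype V] {x : V → ℝ} (hx : x ∈ stdSimplex ℝ V) :
    0 ≤ S.inf' hS x := Finset.le_inf' _ _ fun v _ => hx.1 v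

theorem subset_support_of_inf'_ne_zero [Fintype V] {x : V → ℝ} (hx : x ∈ stdSimplex ℝ V)
    (h : S.inf' hS x ≠ 0) : (S : Set V) ⊆ Function.support x := fun v hv => by
  have h0 := (inf'_nonneg_of_mem_stdSimplex hS hx).lt_of_ne h.symm
  exact (h0.trans_le (Finset.inf'_le _ hv)).ne'

variable [DecidableEq V]

theorem pushMap_mem_stdSimplex [Fintype V] {x : V → ℝ} (hx : x ∈ stdSimplex ℝ V) :
    pushMap S hS a x ∈ stdSimplex ℝ V := by
  have h0 := inf'_nonneg_of_mem_stdSimplex hS hx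
  refine ⟨fun v => ?_, ?_⟩
  · have h1 := hx.1 v
    have h2 : v ∈ S → S.inf' hS x ≤ x v := fun hv => Finset.inf'_le _ hv
    have h3 : 0 ≤ S.card * S.inf' hS x := by positivity
    unfold pushMap
    split_ifs with h4 h5
    · linarith [h2 h4]
    · linarith [h2 h4]
    · linarith
    · linarith
  · have := hx.2
    simp [pushMap, Finset.sum_add_distrib, this]

theorem pushMap_eq_self {x : V → ℝ} (h : S.inf' hS x = 0) : pushMap S hS a x = x := by
  ext v; simp [pushMap, h]

theorem support_pushMap_subset {x : V → ℝ} {F : Finset V} (hSF : S ⊆ F) (ha : a ∈ F)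
    (hx : Function.support x ⊆ (F : Set V)) :
    Function.support (pushMap S hS a x) ⊆ (F : Set V) := fun v hv => by
  by_contra hvF
  have h1 : x v = 0 := by_contra fun h => hvF (hx h)
  have h2 : v ∉ S := fun h => hvF (hSF h)
  have h3 : v ≠ a := fun h => hvF (h ▸ ha)
  exact hv (by simp [pushMap, h1, h2, h3])

theorem exists_pushMap_eq_zero (ha : a ∉ S) (x : V → ℝ) : ∃ v ∈ S, pushMap S hS a x v = 0 := by
  obtain ⟨v, hv, he⟩ := Finset.exists_mem_eq_inf' hS x
  exact ⟨v, hv, by have : v ≠ a := fun h => ha (h ▸ hv)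
                   simp [pushMap, hv, this, he]⟩

end Push

theorem StrictShelling.isContractible {V : Type*} [Fintype V] [DecidableEq V] {n : ℕ}
    {𝓕 : Set (Finset V)} (h : StrictShelling n 𝓕) (hne : 𝓕.Nonempty) :
    (generatedBy 𝓕).IsContractible := by
  induction h with
  | empty => simp at hne
  | add 𝓕 F S h hF hS hnew ih =>
    obtain ⟨a, haF, haS⟩ := Finset.exists_of_ssubset hS
    rw [IsContractible, contractible_iff_id_nullhomotopic]
    rcases 𝓕.eq_empty_or_nonempty with rfl | hne'
    · refine ⟨⟨_, single_mem_realization (.inl rfl) haF⟩, homotopic_of_common_facet _ _ fun x => ?_⟩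
      obtain ⟨-, G, hG, hxG⟩ := mem_realization_generatedBy.1 x.2
      obtain rfl : G = F := by simpa using hG
      exact ⟨G, hG, hxG, (Pi.support_single_subset).trans (by simpa using haF)⟩
    · have hSne : S.Nonempty := by
        by_contra hc
        rw [Finset.not_nonempty_iff_eq_empty] at hc
        obtain ⟨G, hG⟩ := hne'
        exact (hnew ∅ (by simp)).1 ⟨G, hG, by simp⟩ (by simp [hc])
      -- a point that is moved lies in the new facet `F`, in the interior of a face containing `S`
      have hcase : ∀ x ∈ (generatedBy (insert F 𝓕)).realization,
          (S.inf' hSne x = 0 ∧ ∃ G ∈ 𝓕, Function.support x ⊆ (G : Set V)) ∨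
            Function.support x ⊆ (F : Set V) := fun x hx => by
        obtain ⟨hx1, G, rfl | hG, hxG⟩ := mem_realization_generatedBy.1 hx
        · exact .inr hxG
        · refine .inl ⟨?_, G, hG, hxG⟩
          by_contra h0
          have hSG := (subset_support_of_inf'_ne_zero hSne hx1 h0).trans hxG
          exact (hnew S hS.1).1 ⟨G, hG, Finset.coe_subset.1 hSG⟩ subset_rfl
      let r : C((generatedBy (insert F 𝓕)).realization, (generatedBy 𝓕).realization) :=
        ⟨fun x => ⟨pushMap S hSne a x.1, mem_realization_generatedBy.2
          ⟨pushMap_mem_stdSimplex hSne x.2.1, by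
            rcases hcase x.1 x.2 with ⟨h0, hG⟩ | hxF
            · rwa [pushMap_eq_self hSne h0]
            · have hsub := support_pushMap_subset hSne hS.1 haF hxF
              obtain ⟨v, hv, hv0⟩ := exists_pushMap_eq_zero hSne haS x.1
              obtain ⟨G, hG, hFG⟩ := (hnew (F.erase v) (Finset.erase_subset _ _)).2
                fun hc => Finset.notMem_erase v F (hc hv)
              refine ⟨G, hG, fun u hu => hFG (Finset.mem_erase.2 ⟨?_, hsub hu⟩)⟩
              rintro rfl
              exact hu hv0⟩⟩,
          ((continuous_pushMap S hSne a).comp continuous_subtype_val).subtype_mk _⟩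
      let i : C((generatedBy 𝓕).realization, (generatedBy (insert F 𝓕)).realization) :=
        ⟨fun x => ⟨x.1, by
          obtain ⟨hx, G, hG, hxG⟩ := mem_realization_generatedBy.1 x.2
          exact mem_realization_generatedBy.2 ⟨hx, G, .inr hG, hxG⟩⟩, by fun_prop⟩
      have hir : (ContinuousMap.id _).Homotopic (i.comp r) :=
        homotopic_of_common_facet _ _ fun x => by
          rcases hcase x.1 x.2 with ⟨h0, G, hG, hxG⟩ | hxF
          · refine ⟨G, .inr hG, hxG, ?_⟩
            change Function.support (pushMap S hSne a x.1) ⊆ _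
            rwa [pushMap_eq_self hSne h0]
          · exact ⟨F, .inl rfl, hxF, support_pushMap_subset hSne hS.1 haF hxF⟩
      have := ih hne'
      rw [IsContractible, contractible_iff_id_nullhomotopic] at this
      obtain ⟨p, hp⟩ := (this.comp_left r).comp_right i
      exact ⟨p, hir.trans hp⟩

/-! ### Contractions that preserve a face -/

section Collar

variable {V : Type*} (r : Finset V)

/-- The mass that a point of the standard simplex gives to the face `r`. -/
def faceMass (y : V → ℝ) : ℝ := ∑ v ∈ r, y v

/-- The unnormalized form of `collarMap`. -/
def collarWeight [DecidableEq V] (y : V → ℝ) : V → ℝ := fun v =>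
  (if v ∈ r then 1 else max 0 (1 - 2 * faceMass r y)) * y v

/-- A map of the standard simplex that moves each point within its carrier and retracts the collar
`1 / 2 ≤ faceMass r y` of the face `r` onto `r`. -/
noncomputable def collarMap [Fintype V] [DecidableEq V] (y : V → ℝ) : V → ℝ := fun v =>
  collarWeight r y v / ∑ u, collarWeight r y u

theorem continuous_faceMass : Continuous (faceMass r) := by
  unfold faceMass; fun_prop

theorem continuous_collarWeight [DecidableEq V] : Continuous (collarWeight r) := by
  have := continuous_faceMass r
  refine continuous_pi fun v => ?_
  unfold collarWeight
  split_ifs <;> fun_prop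

variable {r} {y : V → ℝ}

theorem faceMass_nonneg [Fintype V] (hy : y ∈ stdSimplex ℝ V) : 0 ≤ faceMass r y :=
  Finset.sum_nonneg fun v _ => hy.1 v

theorem faceMass_le_one [Fintype V] (hy : y ∈ stdSimplex ℝ V) : faceMass r y ≤ 1 :=
  hy.2 ▸ Finset.sum_le_univ_sum_of_nonneg hy.1

theorem faceMass_eq_one [Fintype V] (hy : y ∈ stdSimplex ℝ V)
    (h : Function.support y ⊆ (r : Set V)) : faceMass r y = 1 := by
  rw [← hy.2]
  exact Finset.sum_subset (Finset.subset_univ r) fun v _ hv => by_contra fun h0 => hv (h h0)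

variable [Fintype V] [DecidableEq V]

theorem collarWeight_nonneg (hy : y ∈ stdSimplex ℝ V) (v : V) : 0 ≤ collarWeight r y v := by
  have := hy.1 v
  unfold collarWeight
  split_ifs <;> positivity

theorem sum_collarWeight_pos (hy : y ∈ stdSimplex ℝ V) : 0 < ∑ u, collarWeight r y u := by
  rcases (faceMass_nonneg (r := r) hy).eq_or_lt with h0 | h0
  · have : ∀ u, collarWeight r y u = y u := fun u => by simp [collarWeight, ← h0]
    simp [this, hy.2]
  · refine h0.trans_le ?_
    calc faceMass r y = ∑ u ∈ r, collarWeight r y u :=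
          Finset.sum_congr rfl fun u hu => by simp [collarWeight, hu]
      _ ≤ _ := Finset.sum_le_univ_sum_of_nonneg (collarWeight_nonneg hy)

theorem collarMap_mem_stdSimplex (hy : y ∈ stdSimplex ℝ V) : collarMap r y ∈ stdSimplex ℝ V := by
  have hpos := sum_collarWeight_pos (r := r) hy
  refine ⟨fun v => div_nonneg (collarWeight_nonneg hy v) hpos.le, ?_⟩
  simp only [collarMap]
  rw [← Finset.sum_div, div_self hpos.ne']

theorem support_collarMap_subset : Function.support (collarMap r y) ⊆ Function.support y :=
  fun v hv h0 => hv (by simp [collarMap, collarWeight, h0])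

theorem support_collarMap_subset_of_half_le (h : 1 / 2 ≤ faceMass r y) :
    Function.support (collarMap r y) ⊆ (r : Set V) := fun v hv => by
  by_contra hvr
  have : max 0 (1 - 2 * faceMass r y) = 0 := max_eq_left (by linarith)
  exact hv (by simp [collarMap, collarWeight, show v ∉ r from hvr, this])

end Collar

/-- A contractible complex can be contracted to a point of a given face `r` in such a way that `r`
stays in itself. A collar of `r` is first retracted onto `r` and pulled to a vertex `p` of `r`, so
that `r` becomes a point. A contraction of the complex is then applied with a speed that vanishes
on `r`, which pulls the collar along the track of `p`, and finally this track is shrunk back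
to `p`. -/
theorem PreAbstractSimplicialComplex.IsContractible.exists_homotopicWith {V : Type*} [Fintype V]
    [DecidableEq V] {𝓕 : Set (Finset V)} (hK : (generatedBy 𝓕).IsContractible) {r F₀ : Finset V}
    (hF₀ : F₀ ∈ 𝓕) (hrF₀ : r ⊆ F₀) (hr : r.Nonempty) :
    ∃ p : (generatedBy 𝓕).realization, Function.support p.1 ⊆ (r : Set V) ∧
      (ContinuousMap.id (generatedBy 𝓕).realization).HomotopicWith (ContinuousMap.const _ p)
        fun e => ∀ y, Function.support y.1 ⊆ (r : Set V) →
          Function.support (e y).1 ⊆ (r : Set V) := by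
  obtain ⟨a, har⟩ := hr
  rw [IsContractible, contractible_iff_id_nullhomotopic] at hK
  obtain ⟨q, ⟨H⟩⟩ := hK
  set Y := (generatedBy 𝓕).realization
  have hrF₀' : (r : Set V) ⊆ F₀ := Finset.coe_subset.2 hrF₀
  let p : Y := ⟨Pi.single a 1, single_mem_realization hF₀ (hrF₀ har)⟩
  have hp : Function.support p.1 ⊆ (r : Set V) :=
    (Pi.support_single_subset).trans (by simpa using har)
  have hcm : Continuous fun y : Y => faceMass r y.1 :=
    (continuous_faceMass r).comp continuous_subtype_val
  have hcw : Continuous fun y : Y => collarWeight r y.1 :=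
    (continuous_collarWeight r).comp continuous_subtype_val
  -- the retraction of the collar
  let ρ : C(Y, Y) := ⟨fun y => ⟨collarMap r y.1, by
      obtain ⟨hy, F, hF, hyF⟩ := mem_realization_generatedBy.1 y.2
      exact mem_realization_generatedBy.2
        ⟨collarMap_mem_stdSimplex hy, F, hF, support_collarMap_subset.trans hyF⟩⟩, by
    refine Continuous.subtype_mk (continuous_pi fun v => ?_) _
    exact ((continuous_apply v).comp hcw).div
      (continuous_finsetSum _ fun u _ => (continuous_apply u).comp hcw)
      fun y => (sum_collarWeight_pos y.2.1).ne'⟩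
  -- `lam` is `0` off the collar, and `1` if the mass on `r` is at least `3 / 4`
  let lam : Y → ℝ := fun y => min 1 (max 0 (4 * faceMass r y.1 - 2))
  have hlam : Continuous lam := by fun_prop
  have hlam0 : ∀ y, faceMass r y.1 ≤ 1 / 2 → lam y = 0 := fun y h => by
    simp only [lam]
    rw [max_eq_left (by linarith), min_eq_right zero_le_one]
  have hρr : ∀ y : Y, ¬ faceMass r y.1 ≤ 1 / 2 → Function.support (ρ y).1 ⊆ (r : Set V) :=
    fun y h => support_collarMap_subset_of_half_le (not_le.1 h).le
  -- the collar, and with it `r`, is pulled to `p`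
  let s : C(Y, Y) := ⟨fun y => ⟨AffineMap.lineMap (ρ y).1 p.1 (lam y), by
      by_cases h : faceMass r y.1 ≤ 1 / 2
      · rw [hlam0 y h, AffineMap.lineMap_apply_zero]; exact (ρ y).2
      · exact lineMap_mem_realization (ρ y).2.1 p.2.1
          ⟨F₀, hF₀, (hρr y h).trans hrF₀', hp.trans hrF₀'⟩
          ⟨le_min zero_le_one (le_max_left _ _), min_le_left _ _⟩⟩, by
    simp only [AffineMap.lineMap_apply_module]
    fun_prop⟩
  have hsp : ∀ y : Y, 3 / 4 ≤ faceMass r y.1 → s y = p := fun y h => by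
    have : lam y = 1 := min_eq_left (le_max_of_le_right (by linarith))
    ext1
    change AffineMap.lineMap (ρ y).1 p.1 (lam y) = p.1
    rw [this, AffineMap.lineMap_apply_one]
  have hρA : ∀ y : Y, Function.support y.1 ⊆ (r : Set V) → Function.support (ρ y).1 ⊆ (r : Set V) :=
    fun y h => support_collarMap_subset.trans h
  have hsA : ∀ y : Y, Function.support y.1 ⊆ (r : Set V) → s y = p :=
    fun y h => hsp y (by rw [faceMass_eq_one y.2.1 h]; norm_num)
  -- the speed of the contraction, which is `0` on `r` and `1` where `s` may differ from `p`
  let ν : C(Y, I) := ⟨fun y => ⟨min 1 (4 - 4 * faceMass r y.1),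
      le_min zero_le_one (by linarith [faceMass_le_one (r := r) y.2.1]), min_le_left _ _⟩, by
    refine Continuous.subtype_mk ?_ _
    fun_prop⟩
  have hνA : ∀ y : Y, Function.support y.1 ⊆ (r : Set V) → ν y = 0 := fun y h => by
    ext
    change min 1 (4 - 4 * faceMass r y.1) = 0
    rw [faceMass_eq_one y.2.1 h]; norm_num
  have hν1 : ∀ y : Y, ¬ 3 / 4 ≤ faceMass r y.1 → ν y = 1 := fun y h => by
    ext
    exact min_eq_left (by linarith [not_le.1 h])
  let e : C(Y, Y) := ⟨fun y => H (ν y, p), by fun_prop⟩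
  refine ⟨p, hp, ?_⟩
  refine .trans (g := ρ) (homotopicWith_of_common_facet _ _ _ (fun y => ?_) ?_) <|
    .trans (g := s) (homotopicWith_of_common_facet _ _ _ (fun y => ?_) ?_) <|
    .trans (g := e) ⟨⟨⟨⟨fun x => H (x.1 * ν x.2, s x.2), by fun_prop⟩, fun y => ?_, fun y => ?_⟩,
      fun t y hy => ?_⟩⟩
    ⟨⟨⟨⟨fun x => H (σ x.1 * ν x.2, p), by fun_prop⟩, fun y => ?_, fun y => ?_⟩,
      fun t y hy => ?_⟩⟩
  · obtain ⟨hy, F, hF, hyF⟩ := mem_realization_generatedBy.1 y.2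
    exact ⟨F, hF, hyF, support_collarMap_subset.trans hyF⟩
  · intro t f hf y hy
    rw [hf]
    exact support_lineMap_subset hy (hρA y hy) _
  · by_cases h : faceMass r y.1 ≤ 1 / 2
    · obtain ⟨hy, F, hF, hyF⟩ := mem_realization_generatedBy.1 (ρ y).2
      refine ⟨F, hF, hyF, ?_⟩
      change Function.support (AffineMap.lineMap (ρ y).1 p.1 (lam y)) ⊆ _
      rwa [hlam0 y h, AffineMap.lineMap_apply_zero]
    · exact ⟨F₀, hF₀, (hρr y h).trans hrF₀',
        (support_lineMap_subset (hρr y h) hp _).trans hrF₀'⟩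
  · intro t f hf y hy
    rw [hf, hsA y hy]
    exact support_lineMap_subset (hρA y hy) hp _
  · simp
  · change H (1 * ν y, s y) = H (ν y, p)
    rw [one_mul]
    by_cases h : 3 / 4 ≤ faceMass r y.1
    · rw [hsp y h]
    · rw [hν1 y h, H.apply_one, H.apply_one]; rfl
  · change Function.support (H (t * ν y, s y)).1 ⊆ _
    rw [hνA y hy, mul_zero, H.apply_zero, hsA y hy]
    exact hp
  · change H (σ 0 * ν y, p) = H (ν y, p)
    rw [unitInterval.symm_zero, one_mul]
  · change H (σ 1 * ν y, p) = p
    rw [unitInterval.symm_one, zero_mul, H.apply_zero]; rfl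
  · change Function.support (H (σ t * ν y, p)).1 ⊆ _
    rw [hνA y hy, mul_zero, H.apply_zero]
    exact hp

/-! ### Copies glued along a face -/

section Pushforward

variable {V W U : Type*} [Fintype V] [DecidableEq W] [DecidableEq U]

/-- The affine map of standard simplices induced by a map of vertices. -/
def pushforward (f : V → W) (x : V → ℝ) : W → ℝ := fun w => ∑ v, if f v = w then x v else 0

theorem continuous_pushforward (f : V → W) : Continuous (pushforward f) := by
  refine continuous_pi fun w => continuous_finsetSum _ fun v _ => ?_
  split_ifs <;> fun_prop

theorem pushforward_mem_stdSimplex [Fintype W] (f : V → W) {x : V → ℝ} (hx : x ∈ stdSimplex ℝ V) :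
    pushforward f x ∈ stdSimplex ℝ W := by
  refine ⟨fun w => Finset.sum_nonneg fun v _ => ?_, ?_⟩
  · split_ifs
    exacts [hx.1 v, le_rfl]
  · simp only [pushforward]
    rw [Finset.sum_comm]
    simpa using hx.2

theorem support_pushforward_subset (f : V → W) (x : V → ℝ) :
    Function.support (pushforward f x) ⊆ f '' Function.support x := fun w hw => by
  obtain ⟨v, -, hv⟩ := Finset.exists_ne_zero_of_sum_ne_zero hw
  split_ifs at hv with h
  · exact ⟨v, hv, h⟩
  · exact absurd rfl hv

theorem pushforward_congr {f g : V → W} {x : V → ℝ} (h : ∀ v ∈ Function.support x, f v = g v) :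
    pushforward f x = pushforward g x := by
  ext w
  refine Finset.sum_congr rfl fun v _ => ?_
  by_cases hv : x v = 0
  · simp [hv]
  · rw [h v hv]

theorem pushforward_id [Fintype W] (x : W → ℝ) : pushforward id x = x := by
  ext w; simp [pushforward]

theorem pushforward_comp [Fintype W] (g : W → U) (f : V → W) (x : V → ℝ) :
    pushforward g (pushforward f x) = pushforward (g ∘ f) x := by
  ext u
  simp only [pushforward, Function.comp_apply, ← Finset.sum_filter]
  rw [Finset.sum_comm' (t' := Finset.univ.filter fun v => g (f v) = u) (s' := fun v => {f v})]
  · simp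
  · aesop

end Pushforward

namespace PreAbstractSimplicialComplex

variable {V : Type*} {r : Finset V} {k d : ℕ} {𝓕 : Set (Finset V)}

/-- The map that identifies all the copies. -/
def foldVertex (r : Finset V) (k : ℕ) : GlueVertex r k → V :=
  Sum.elim Subtype.val fun p => p.1.1

variable [DecidableEq V]

@[simp]
theorem foldVertex_copyVertex (i : Fin k) (v : V) : foldVertex r k (copyVertex r i v) = v := by
  unfold copyVertex
  split_ifs <;> rfl

theorem copyVertex_injective (i : Fin k) : Function.Injective (copyVertex r i) :=
  Function.LeftInverse.injective (foldVertex_copyVertex i)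

theorem copyVertex_of_mem (i j : Fin k) {v : V} (hv : v ∈ r) :
    copyVertex r i v = copyVertex r j v := by
  simp [copyVertex, hv]

theorem mem_of_copyVertex_eq {i j : Fin k} (hij : i ≠ j) {u v : V}
    (h : copyVertex r i u = copyVertex r j v) : u = v ∧ v ∈ r := by
  have huv : u = v := by simpa using congrArg (foldVertex r k) h
  refine ⟨huv, ?_⟩
  subst huv
  by_contra hu
  simp [copyVertex, hu] at h
  exact hij h

theorem exists_copyVertex_eq (hk : 0 < k) (w : GlueVertex r k) : ∃ i v, copyVertex r i v = w := by
  rcases w with ⟨v, hv⟩ | ⟨⟨v, hv⟩, i⟩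
  · exact ⟨⟨0, hk⟩, v, by simp [copyVertex, hv]⟩
  · exact ⟨i, v, by simp [copyVertex, hv]⟩

/-- The facets of the copies with index in `J`. -/
def copyFacets (r : Finset V) (J : Set (Fin k)) (𝓕 : Set (Finset V)) :
    Set (Finset (GlueVertex r k)) :=
  ⋃ i ∈ J, (fun F => F.image (copyVertex r i)) '' 𝓕

theorem mem_copyFacets {J : Set (Fin k)} {G : Finset (GlueVertex r k)} :
    G ∈ copyFacets r J 𝓕 ↔ ∃ i ∈ J, ∃ F ∈ 𝓕, F.image (copyVertex r i) = G := by
  simp [copyFacets]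

theorem glueCopies_generatedBy :
    (generatedBy 𝓕).glueCopies r k = generatedBy (copyFacets r (Set.univ : Set (Fin k)) 𝓕) := by
  apply PreAbstractSimplicialComplex.ext
  have : ((generatedBy 𝓕).glueCopies r k).faces =
      ⋃ i : Fin k, ((generatedBy 𝓕).map (copyVertex r i)).faces := by
    change (⋃ K ∈ Set.range fun i : Fin k => (generatedBy 𝓕).map (copyVertex r i), K.faces) = _
    rw [Set.biUnion_range]
  rw [this]
  ext s
  simp only [Set.mem_iUnion, mem_faces_generatedBy]
  constructor
  · rintro ⟨i, t, ⟨ht, F, hF, htF⟩, rfl⟩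
    exact ⟨ht.image _, _, mem_copyFacets.2 ⟨i, trivial, F, hF, rfl⟩, Finset.image_mono _ htF⟩
  · rintro ⟨hs, G, hG, hsG⟩
    obtain ⟨i, -, F, hF, rfl⟩ := mem_copyFacets.1 hG
    obtain ⟨t, htF, rfl⟩ := Finset.subset_image_iff.1 hsG
    exact ⟨i, t, ⟨Finset.image_nonempty.1 hs, F, hF, htF⟩, rfl⟩

theorem card_of_mem_copyFacets (h : ∀ F ∈ 𝓕, F.card = d) {J : Set (Fin k)} :
    ∀ G ∈ copyFacets r J 𝓕, G.card = d := fun G hG => by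
  obtain ⟨i, -, F, hF, rfl⟩ := mem_copyFacets.1 hG
  rw [Finset.card_image_of_injective _ (copyVertex_injective i), h F hF]

/-- The gluing of contractible complexes along a face is contractible. -/
theorem IsContractible.glueCopies [Fintype V] (hK : (generatedBy 𝓕).IsContractible) {F₀ : Finset V}
    (hF₀ : F₀ ∈ 𝓕) (hrF₀ : r ⊆ F₀) (hr : r.Nonempty) (hk : 0 < k) :
    ((generatedBy 𝓕).glueCopies r k).IsContractible := by
  obtain ⟨p, hp, ⟨H⟩⟩ := hK.exists_homotopicWith hF₀ hrF₀ hr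
  rw [glueCopies_generatedBy, IsContractible, contractible_iff_id_nullhomotopic]
  let X := (generatedBy (copyFacets r (Set.univ : Set (Fin k)) 𝓕)).realization
  let Y := (generatedBy 𝓕).realization
  let inc : Fin k → C(Y, X) := fun i => ⟨fun y => ⟨pushforward (copyVertex r i) y.1, by
      obtain ⟨hy, F, hF, hyF⟩ := mem_realization_generatedBy.1 y.2
      refine mem_realization_generatedBy.2 ⟨pushforward_mem_stdSimplex _ hy, _,
        mem_copyFacets.2 ⟨i, trivial, F, hF, rfl⟩, (support_pushforward_subset _ _).trans ?_⟩
      rw [Finset.coe_image]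
      exact Set.image_mono hyF⟩,
    by exact ((continuous_pushforward _).comp continuous_subtype_val).subtype_mk _⟩
  let fold : C(X, Y) := ⟨fun x => ⟨pushforward (foldVertex r k) x.1, by
      obtain ⟨hx, G, hG, hxG⟩ := mem_realization_generatedBy.1 x.2
      obtain ⟨i, -, F, hF, rfl⟩ := mem_copyFacets.1 hG
      refine mem_realization_generatedBy.2 ⟨pushforward_mem_stdSimplex _ hx, F, hF,
        (support_pushforward_subset _ _).trans ?_⟩
      rintro _ ⟨w, hw, rfl⟩
      obtain ⟨v, hv, rfl⟩ := Finset.mem_image.1 (hxG hw)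
      simpa using hv⟩,
    by exact ((continuous_pushforward _).comp continuous_subtype_val).subtype_mk _⟩
  let Xi : Fin k → Set X := fun i => {x | ∀ w ∉ Set.range (copyVertex r i), x.1 w = 0}
  have hXi_closed : ∀ i, IsClosed (Xi i) := fun i => by
    simp only [Xi, Set.ofPred_forall]
    refine isClosed_iInter fun w => isClosed_iInter fun _ => ?_
    exact isClosed_eq ((continuous_apply w).comp continuous_subtype_val) continuous_const
  have hcov : ∀ x : X, ∃ i, x ∈ Xi i := fun x => by
    obtain ⟨hx, G, hG, hxG⟩ := mem_realization_generatedBy.1 x.2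
    obtain ⟨i, -, F, hF, rfl⟩ := mem_copyFacets.1 hG
    refine ⟨i, fun w hw => by_contra fun h0 => hw ?_⟩
    obtain ⟨v, -, rfl⟩ := Finset.mem_image.1 (hxG h0)
    exact ⟨v, rfl⟩
  choose idx hidx using hcov
  have hinc_fold : ∀ i, ∀ x ∈ Xi i, inc i (fold x) = x := fun i x hx => by
    ext1
    change pushforward _ (pushforward _ x.1) = x.1
    rw [pushforward_comp]
    refine (pushforward_congr (g := id) fun w hw => ?_).trans (pushforward_id _)
    obtain ⟨v, rfl⟩ : w ∈ Set.range (copyVertex r i) := by_contra fun h => hw (hx w h)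
    simp
  have hinc_eq : ∀ i j, ∀ y : Y, Function.support y.1 ⊆ (r : Set V) → inc i y = inc j y :=
    fun i j y hy => by
      ext1
      exact pushforward_congr fun v hv => copyVertex_of_mem i j (hy hv)
  -- on the intersection of two copies the homotopy stays in the common face
  have hglue : ∀ i (t : I), ∀ x ∈ Xi i, inc (idx x) (H (t, fold x)) = inc i (H (t, fold x)) :=
    fun i t x hx => by
      by_cases hi : idx x = i
      · rw [hi]
      · refine hinc_eq _ _ _ (H.prop t (fold x) fun v hv => ?_)
        obtain ⟨w, hw, rfl⟩ := support_pushforward_subset _ _ hv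
        obtain ⟨u, rfl⟩ : w ∈ Set.range (copyVertex r i) := by_contra fun h => hw (hx w h)
        obtain ⟨u', hu'⟩ : copyVertex r i u ∈ Set.range (copyVertex r (idx x)) :=
          by_contra fun h => hw (hidx x _ h)
        rw [foldVertex_copyVertex]
        exact (mem_of_copyVertex_eq hi hu').2
  refine ⟨inc ⟨0, hk⟩ p, ⟨⟨⟨fun z => inc (idx z.2) (H (z.1, fold z.2)), ?_⟩, fun x => ?_,
    fun x => ?_⟩⟩⟩
  · refine (locallyFinite_of_finite fun i => Prod.snd ⁻¹' Xi i : LocallyFinite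
      fun i : Fin k => (Prod.snd ⁻¹' Xi i : Set (I × X))).continuous ?_
      (fun i => (hXi_closed i).preimage continuous_snd) fun i => ?_
    · exact Set.eq_univ_of_forall fun z => Set.mem_iUnion.2 ⟨idx z.2, hidx z.2⟩
    · refine ContinuousOn.congr (f := fun z => inc i (H (z.1, fold z.2))) ?_
        fun z hz => hglue i z.1 z.2 hz
      have := H.continuous
      exact Continuous.continuousOn (by fun_prop)
  · change inc (idx x) (H (0, fold x)) = x
    rw [H.apply_zero]
    exact hinc_fold _ x (hidx x)
  · change inc (idx x) (H (1, fold x)) = inc ⟨0, hk⟩ p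
    rw [H.apply_one]
    exact hinc_eq _ _ p hp

end PreAbstractSimplicialComplex

/-! ### Combinatorics of the glued complex -/

section Glue

variable {V : Type*} [DecidableEq V] {r : Finset V} {k d : ℕ} {𝓕 : Set (Finset V)}

/-- A ridge of one copy that is free there is `r`, which lies in facets of all the copies. -/
theorem HasUniqueFreeRidge.exists_ne_copyFacets (h : HasUniqueFreeRidge d 𝓕 r)
    (hcard : ∀ F ∈ 𝓕, F.card = d + 1) (hk : 2 ≤ k) {ρ : Finset (GlueVertex r k)}
    (hρ : ρ.card = d) {F : Finset (GlueVertex r k)} (hF : F ∈ copyFacets r Set.univ 𝓕)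
    (hρF : ρ ⊆ F) : ∃ G ∈ copyFacets r Set.univ 𝓕, G ≠ F ∧ ρ ⊆ G := by
  obtain ⟨i, -, F, hF', rfl⟩ := mem_copyFacets.1 hF
  obtain ⟨ρ, hρ', rfl⟩ := Finset.subset_image_iff.1 hρF
  rw [Finset.card_image_of_injective _ (copyVertex_injective i)] at hρ
  have hρF' : ρ ⊆ F := by exact_mod_cast hρ'
  by_cases hne : ρ = r
  · subst hne
    have : Nontrivial (Fin k) := Fin.nontrivial_iff_two_le.2 hk
    obtain ⟨j, hj⟩ := _root_.exists_ne i
    refine ⟨_, mem_copyFacets.2 ⟨j, trivial, F, hF', rfl⟩, fun e => ?_, ?_⟩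
    · have hsub : F ⊆ ρ := fun v hv => by
        have : copyVertex ρ j v ∈ F.image (copyVertex ρ i) := e ▸ Finset.mem_image_of_mem _ hv
        obtain ⟨u, -, hu⟩ := Finset.mem_image.1 this
        exact (mem_of_copyVertex_eq hj.symm hu).2
      have := Finset.card_le_card hsub
      have := hcard F hF'
      omega
    · rw [Finset.image_congr fun v hv => copyVertex_of_mem i j hv]
      exact Finset.image_mono _ hρF'
  · obtain ⟨G, hG, hGF, hρG⟩ := h.exists_ne ρ hρ hne F hF' hρF'
    exact ⟨_, mem_copyFacets.2 ⟨i, trivial, G, hG, rfl⟩,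
      fun e => hGF (Finset.image_injective (copyVertex_injective i) e), Finset.image_mono _ hρG⟩

/-- The identification of the copies is injective on a clique, so a clique on `d + 2` vertices
would give one in a single copy. -/
theorem StrictShelling.card_ne_of_erase_mem_copyFacets (h : StrictShelling (d + 1) 𝓕)
    (hd : d ≠ 0) {T : Finset (GlueVertex r k)}
    (hT : ∀ v ∈ T, T.erase v ∈ copyFacets r Set.univ 𝓕) : T.card ≠ d + 2 := by
  intro hTc
  have hinj : Set.InjOn (foldVertex r k) (T : Set (GlueVertex r k)) := by
    intro u hu v hv huv
    obtain ⟨w, hw, hwuv⟩ : ∃ w ∈ T, w ∉ ({u, v} : Finset _) :=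
      Finset.exists_mem_notMem_of_card_lt_card (Finset.card_le_two.trans_lt (by omega))
    obtain ⟨i, -, F, hF, hFT⟩ := mem_copyFacets.1 (hT w hw)
    have hu' : u ∈ F.image (copyVertex r i) := by rw [hFT]; grind
    have hv' : v ∈ F.image (copyVertex r i) := by rw [hFT]; grind
    obtain ⟨a, -, rfl⟩ := Finset.mem_image.1 hu'
    obtain ⟨b, -, rfl⟩ := Finset.mem_image.1 hv'
    exact congrArg _ (by simpa using huv)
  refine h.card_ne_of_erase_mem (T := T.image (foldVertex r k)) (by omega) (fun x hx => ?_)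
    (by rw [Finset.card_image_of_injOn hinj, hTc])
  obtain ⟨v, hv, rfl⟩ := Finset.mem_image.1 hx
  obtain ⟨i, -, F, hF, hFT⟩ := mem_copyFacets.1 (hT v hv)
  have : (T.image (foldVertex r k)).erase (foldVertex r k v) = F := by
    have h1 : F = (T.erase v).image (foldVertex r k) := by
      rw [← hFT, Finset.image_image]
      ext x; simp
    rw [h1]
    ext x
    simp only [Finset.mem_erase, Finset.mem_image]
    constructor
    · rintro ⟨hne, u, hu, rfl⟩
      exact ⟨u, ⟨fun e => hne (e ▸ rfl), hu⟩, rfl⟩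
    · rintro ⟨u, ⟨hne, hu⟩, rfl⟩
      exact ⟨fun e => hne (hinj hu hv e), u, hu, rfl⟩
  rwa [this]

/-- The copies are added one at a time. A new copy meets the earlier ones in the simplex `r`. -/
theorem StrictShelling.isConstructible_glueCopies (h : StrictShelling (d + 2) 𝓕) {F₀ : Finset V}
    (hF₀ : F₀ ∈ 𝓕) (hrF₀ : r ⊆ F₀) (hr : r.card = d + 1) (hk : 0 < k) :
    ((generatedBy 𝓕).glueCopies r k).IsConstructible (d + 1) := by
  rw [glueCopies_generatedBy]
  have hcopy : ∀ i : Fin k,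
      (generatedBy ((fun F => F.image (copyVertex r i)) '' 𝓕)).IsConstructible (d + 1) := fun i =>
    (h.image (copyVertex_injective i)).isConstructible ⟨_, F₀, hF₀, rfl⟩
  have key : ∀ J : Finset (Fin k), J.Nonempty →
      (generatedBy (copyFacets r (J : Set (Fin k)) 𝓕)).IsConstructible (d + 1) := fun J hJ => by
    induction hJ using Finset.Nonempty.cons_induction with
    | singleton i => simpa [copyFacets] using hcopy i
    | cons i J hi hJ ih =>
      have heq : copyFacets r ((Finset.cons i J hi : Finset (Fin k)) : Set (Fin k)) 𝓕 =
          copyFacets r (J : Set (Fin k)) 𝓕 ∪ (fun F => F.image (copyVertex r i)) '' 𝓕 := by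
        simp [copyFacets, Set.union_comm]
      rw [heq, generatedBy_union]
      refine .union d _ _ ih (hcopy i) ?_
      have := isConstructible_generatedBy_singleton (F := r.image (copyVertex r i)) (d := d)
        (by rw [Finset.card_image_of_injective _ (copyVertex_injective i), hr])
      convert! this using 1
      apply PreAbstractSimplicialComplex.ext
      ext s
      simp only [mem_faces_inf, mem_faces_generatedBy, Set.mem_singleton_iff, exists_eq_left,
        Set.exists_mem_image]
      constructor
      · rintro ⟨⟨hs, G, hG, hsG⟩, -, F, hF, hsF⟩
        refine ⟨hs, fun w hw => ?_⟩
        obtain ⟨j, hj, F', hF', rfl⟩ := mem_copyFacets.1 hG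
        obtain ⟨u, -, hu⟩ := Finset.mem_image.1 (hsG hw)
        obtain ⟨v, -, rfl⟩ := Finset.mem_image.1 (hsF hw)
        exact Finset.mem_image_of_mem _
          (mem_of_copyVertex_eq (fun e => hi (by rw [← e]; exact hj)) hu).2
      · rintro ⟨hs, hsr⟩
        obtain ⟨j, hj⟩ := hJ
        refine ⟨⟨hs, _, mem_copyFacets.2 ⟨j, hj, F₀, hF₀, rfl⟩, hsr.trans ?_⟩, hs, F₀, hF₀,
          hsr.trans (Finset.image_mono _ hrF₀)⟩
        rw [Finset.image_congr fun v hv => copyVertex_of_mem i j hv]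
        exact Finset.image_mono _ hrF₀
  have := key Finset.univ ⟨⟨0, hk⟩, Finset.mem_univ _⟩
  rwa [Finset.coe_univ] at this

end Glue

/-! ### Cliques and ridge-chordality -/

namespace PreAbstractSimplicialComplex

variable {V : Type*} {d : ℕ} {𝓕 : Set (Finset V)}

theorem IsClique.card_le [DecidableEq V]
    (hT : ∀ T : Finset V, (∀ v ∈ T, T.erase v ∈ 𝓕) → T.card ≠ d + 2) {s : Finset V}
    (hs : IsClique d 𝓕 (s : Set V)) : s.card ≤ d + 1 := by
  by_contra! hc
  obtain ⟨T, hTs, hTc⟩ := Finset.exists_subset_card_eq (show d + 2 ≤ s.card by omega)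
  refine hT T (fun v hv => hs _ ?_ (by rw [Finset.card_erase_of_mem hv, hTc]; rfl)) hTc
  exact Finset.coe_subset.2 ((Finset.erase_subset _ _).trans hTs)

/-- Without free ridges, the star of a ridge has at least `d + 2` vertices, so in the absence of
cliques of this size there is no ridge to begin with. -/
theorem not_ridgeReducible [DecidableEq V] (hne : 𝓕.Nonempty) (hcard : ∀ F ∈ 𝓕, F.card = d + 1)
    (hfree : ∀ ρ : Finset V, ρ.card = d → ∀ F ∈ 𝓕, ρ ⊆ F → ∃ G ∈ 𝓕, G ≠ F ∧ ρ ⊆ G)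
    (hT : ∀ T : Finset V, (∀ v ∈ T, T.erase v ∈ 𝓕) → T.card ≠ d + 2) : ¬ RidgeReducible d 𝓕 := by
  intro h
  cases h with
  | empty => simp at hne
  | delete _ ρ hρ hr hclique _ =>
    obtain ⟨F, hF, hρF⟩ := hr
    obtain ⟨G, hG, hGF, hρG⟩ := hfree ρ hρ F hF hρF
    have hFG : IsClique d 𝓕 ((F ∪ G : Finset V) : Set V) := fun t ht => hclique t fun v hv => by
      rcases Finset.mem_union.1 (ht hv) with h | h
      exacts [⟨F, hF, hρF, h⟩, ⟨G, hG, hρG, h⟩]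
    have hle := IsClique.card_le hT hFG
    have h1 : F = F ∪ G := Finset.eq_of_subset_of_card_le Finset.subset_union_left
      (by rw [hcard F hF]; exact hle)
    have h2 : G = F ∪ G := Finset.eq_of_subset_of_card_le Finset.subset_union_right
      (by rw [hcard G hG]; exact hle)
    exact hGF (h2.trans h1.symm)

theorem hasDim_cliqueComplex [DecidableEq V] (hne : 𝓕.Nonempty)
    (hcard : ∀ F ∈ 𝓕, F.card = d + 1)
    (hT : ∀ T : Finset V, (∀ v ∈ T, T.erase v ∈ 𝓕) → T.card ≠ d + 2) :
    ((generatedBy 𝓕).cliqueComplex d).HasDim d := by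
  obtain ⟨F, hF⟩ := hne
  refine ⟨⟨F, ⟨Finset.card_pos.1 (by rw [hcard F hF]; omega), fun v hv => ?_, ?_⟩, hcard F hF⟩, ?_⟩
  · exact ⟨Finset.singleton_nonempty v, F, hF, by simpa using hv⟩
  · intro t ht htc
    rw [facets_generatedBy hcard,
      Finset.eq_of_subset_of_card_le (Finset.coe_subset.1 ht) (by rw [htc, hcard F hF])]
    exact hF
  · rintro s ⟨-, -, hs⟩
    rw [facets_generatedBy hcard] at hs
    exact IsClique.card_le hT hs

end PreAbstractSimplicialComplex

theorem mainTheorem2 (d : ℕ) (hd : 2 ≤ d) :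
    ∃ (C : PreAbstractSimplicialComplex (Fin (2 ^ d + d + 1))) (r : Finset (Fin (2 ^ d + d + 1))),
      C.IsShellable d ∧ C.IsContractible ∧ C.HasDim d ∧ C.vertexSet.ncard = 2 ^ d + d + 1 ∧
      C.IsFreeRidge d r ∧ (∀ r', C.IsFreeRidge d r' → r' = r) ∧
      ∀ k : ℕ, 2 ≤ k →
        (C.glueCopies r k).IsConstructible d ∧
        (C.glueCopies r k).IsContractible ∧
        (C.glueCopies r k).HasDim d ∧
        (C.glueCopies r k).vertexSet.ncard = k * 2 ^ d + k + d ∧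
        ¬ (C.glueCopies r k).IsRidgeChordal d ∧
        (¬ ∃ s, (C.glueCopies r k).IsFreeRidge d s) ∧
        ((C.glueCopies r k).cliqueComplex d).HasDim d := by
  have hpow : 4 ≤ 2 ^ d := Nat.pow_le_pow_right (n := 2) (by norm_num) hd
  obtain ⟨𝓕, r, U, hsh, hr, hU, hUc⟩ :=
    exists_strictShelling (N := 2 ^ d + d + 1) hd (by omega) le_rfl
  obtain ⟨F₀, ⟨hF₀, hrF₀⟩, -⟩ := hr.existsUnique
  have hd0 : d ≠ 0 := by omega
  have hrne : r.Nonempty := Finset.card_pos.1 (by rw [hr.card_eq]; omega)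
  have hcard := hsh.card_eq
  have hcontr := hsh.isContractible ⟨F₀, hF₀⟩
  have hvertex : ∀ v, ∃ F ∈ 𝓕, v ∈ F := fun v => (hU v).1 <| by
    rw [(Finset.card_eq_iff_eq_univ U).1 (by rw [hUc, Fintype.card_fin])]
    exact Finset.mem_univ v
  refine ⟨generatedBy 𝓕, r, hsh.isShellable ⟨F₀, hF₀⟩, hcontr,
    hasDim_generatedBy hcard ⟨F₀, hF₀⟩, ?_, hr.isFreeRidge hcard hd0,
    fun r' h' => hr.eq_of_isFreeRidge hcard hd0 h', fun k hk => ?_⟩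
  · have : (generatedBy 𝓕).vertexSet = Set.univ := Set.eq_univ_of_forall fun v =>
      ⟨Finset.singleton_nonempty v, by simpa using hvertex v⟩
    rw [this, Set.ncard_univ, Nat.card_eq_fintype_card, Fintype.card_fin]
  · have hk0 : 0 < k := by omega
    have hne : (copyFacets r (Set.univ : Set (Fin k)) 𝓕).Nonempty :=
      ⟨_, mem_copyFacets.2 ⟨⟨0, hk0⟩, trivial, F₀, hF₀, rfl⟩⟩
    have hcard' := card_of_mem_copyFacets (r := r) (J := (Set.univ : Set (Fin k))) hcard
    have hT : ∀ T : Finset (GlueVertex r k), (∀ v ∈ T, T.erase v ∈ copyFacets r Set.univ 𝓕) →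
        T.card ≠ d + 2 := fun T hT => hsh.card_ne_of_erase_mem_copyFacets hd0 hT
    refine ⟨?_, hcontr.glueCopies hF₀ hrF₀ hrne hk0, ?_, ?_, ?_, ?_, ?_⟩
    · obtain ⟨e, rfl⟩ : ∃ e, d = e + 1 := ⟨d - 1, by omega⟩
      exact hsh.isConstructible_glueCopies hF₀ hrF₀ hr.card_eq hk0
    all_goals rw [glueCopies_generatedBy]
    · exact hasDim_generatedBy hcard' hne
    · have : (generatedBy (copyFacets r (Set.univ : Set (Fin k)) 𝓕)).vertexSet = Set.univ :=
        Set.eq_univ_of_forall fun w => by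
          obtain ⟨i, v, rfl⟩ := exists_copyVertex_eq hk0 w
          obtain ⟨F, hF, hv⟩ := hvertex v
          exact ⟨Finset.singleton_nonempty _, _, mem_copyFacets.2 ⟨i, trivial, F, hF, rfl⟩,
            by simpa using ⟨v, hv, rfl⟩⟩
      rw [this, Set.ncard_univ, Nat.card_eq_fintype_card, Fintype.card_sum, Fintype.card_prod,
        Fintype.card_coe, Fintype.card_subtype_compl, Fintype.card_coe, Fintype.card_fin,
        Fintype.card_fin, hr.card_eq, show 2 ^ d + d + 1 - d = 2 ^ d + 1 by omega]
      ring
    · rw [IsRidgeChordal, facets_generatedBy hcard']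
      exact not_ridgeReducible hne hcard'
        (fun ρ hρ F hF hρF => hr.exists_ne_copyFacets hcard hk hρ hF hρF) hT
    · rintro ⟨s, hs⟩
      obtain ⟨hsc, F, ⟨hF, hsF⟩, hu⟩ := (isFreeRidge_generatedBy_iff hcard' hd0).1 hs
      obtain ⟨G, hG, hGF, hsG⟩ := hr.exists_ne_copyFacets hcard hk hsc hF hsF
      exact hGF (hu G ⟨hG, hsG⟩)
    · exact hasDim_cliqueComplex hne hcard' hT
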